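/- **Setting.** Let $M$ be a smooth Hausdorff $4$-manifold with a smooth metric $g$ of signature $(1,3)$, oriented by a smooth volume form $\tau$ with $\tau\cdot\tau=-1$. Let $D,D'$ be smooth $g$-compatible connections ($Dg=D'g=0$, torsion allowed). In any local moving frame $(e_\alpha)$ with dual frame $(\theta^\rho)$ put $$T^\rho_{\alpha\beta}=\theta^\rho(D_{e_\alpha}e_\beta-D_{e_\beta}e_\alpha-[e_\alpha,e_\beta]),\qquad R_\mu{}^\rho{}_{\alpha\beta}=\theta^\rho\big((D_{e_\alpha}D_{e_\beta}-D_{e_\beta}D_{e_\alpha}-D_{[e_\alpha,e_\beta]})e_\mu\big),$$ $\mathcal T^\rho=\frac12T^\rho_{\alpha\beta}\theta^\alpha\wedge\theta^\beta$, $\mathcal R^\rho_\mu=\frac12R_\mu{}^\rho{}_{\alpha\beta}\theta^\alpha\wedge\theta^\beta$ (and $\mathcal T'^\rho,\mathcal R'^\rho_\mu$ likewise for $D'$), $R_{\mu\nu}=R_\mu{}^\rho{}_{\rho\nu}$, $R=g^{\mu\nu}R_{\mu\nu}$, $G_{\mu\nu}=R_{\mu\nu}-\frac12g_{\mu\nu}R$,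 $\epsilon_{\mu\nu\rho\sigma}=\tau(e_\mu,e_\nu,e_\rho,e_\sigma)$ (that is, $\sqrt{|\det g|}$ times the Levi-Civita symbol in a positively oriented frame). The Hodge dual of the $2$-form $\frac12B_{\alpha\beta}\theta^\alpha\wedge\theta^\beta$ has components $\frac12g^{\alpha\kappa}g^{\beta\iota}B_{\alpha\beta}\epsilon_{\kappa\iota\lambda\sigma}$. Let $T^{*\rho}_{\alpha\beta}$ and $R^*{}_\mu{}^\rho{}_{\alpha\beta}$ be the components of $\star\mathcal T^\rho$ and $\star\mathcal R^\rho_\mu$, and $R^*=g^{\mu\beta}R^*{}_\mu{}^\rho{}_{\rho\beta}$. Upper indices are lowered in place: $T_{\rho\alpha\beta}=g_{\rho\sigma}T^\sigma_{\alpha\beta}$, $T^*_{\rho\alpha\beta}=g_{\rho\sigma}T^{*\sigma}_{\alpha\beta}$, $R_{\mu\rho\alpha\beta}=g_{\rho\sigma}R_\mu{}^\sigma{}_{\alpha\beta}$, and likewise for $R^*$. $\sum_{(\mu\alpha\beta)}$ denotes the sum over cyclic permutations. **Hypotheses.** $\mathcal T'^\rho=\star\mathcal T^\rho$ and $\mathcal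 R'^\rho_\mu=\star\mathcal R^\rho_\mu$ in every moving frame, and $G_{\mu\nu}=\mathbf T_{\mu\nu}$ and $G'_{\mu\nu}=\mathbf T'_{\mu\nu}$, where $\mathbf T,\mathbf T'$ are the energy–momentum tensor fields of $D$ and $D'$; write $\mathbf T_\mu^{\kappa}=\mathbf T_{\mu\nu}g^{\nu\kappa}$ and $\mathbf T_\kappa^\kappa$ for the trace, and likewise for $\mathbf T'$. **Claim.** In every moving frame, for all indices: (a) $$-\Big(\epsilon_{\mu\alpha\beta\kappa}\mathbf T_\rho^{\kappa}-\tfrac12R\,\epsilon_{\rho\mu\alpha\beta}\Big)=\sum_{(\mu\alpha\beta)}\big(D'_\mu T^*_{\rho\alpha\beta}-T^{*\kappa}_{\mu\beta}T^*_{\rho\kappa\alpha}\big);$$ (b) $$\epsilon_{\mu\alpha\beta\kappa}\mathbf T'^{\kappa}_\rho-\tfrac12R^*\epsilon_{\rho\mu\alpha\beta}=\sum_{(\mu\alpha\beta)}\big(D_\mu T_{\rho\alpha\beta}-T^\kappa_{\mu\beta}T_{\rho\kappa\alpha}\big).$$ (c) If $D$ is the Levi-Civita connection of $g$ (i.e.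 its torsion vanishes), then $D'$ is torsion free, and $$\epsilon_{\rho\lambda\sigma\kappa}\mathbf T_\mu^\kappa=-\tfrac12\mathbf T_\kappa^\kappa\,\epsilon_{\mu\rho\lambda\sigma},\qquad \epsilon_{\rho\lambda\sigma\kappa}\mathbf T'^\kappa_\mu=-\tfrac12\mathbf T'^\kappa_\kappa\,\epsilon_{\mu\rho\lambda\sigma},\qquad \sum_{(\mu\nu\rho)}D'_\mu R^*_{\beta\alpha\nu\rho}=\sum_{(\mu\nu\rho)}D_\mu R_{\beta\alpha\nu\rho}.$$ -/

import Mathlib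

open Bundle NormedSpace
open scoped Manifold ContDiff Topology

namespace RiemannCartan

/-- The model space of a four-dimensional manifold. -/
abbrev E4 : Type := EuclideanSpace ℝ (Fin 4)

section Structures

variable (M : Type*) [TopologicalSpace M] [ChartedSpace E4 M] [IsManifold (𝓡 4) ∞ M]

/-- A smooth metric tensor of signature `(1,3)` on a four-dimensional manifold. -/
structure LorentzMetric where
  /-- the metric at a point -/
  val : ∀ x : M, TangentSpace (𝓡 4) x →L[ℝ] TangentSpace (𝓡 4) x →L[ℝ] ℝ
  symm : ∀ (x : M) (v w : TangentSpace (𝓡 4) x), val x v w = val x w v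
  /-- at each point there is an orthonormal basis with squares `+1, -1, -1, -1` -/
  signature : ∀ x : M, ∃ b : Module.Basis (Fin 4) ℝ (TangentSpace (𝓡 4) x),
    ∀ i j, val x (b i) (b j) = if i = j then (if i = 0 then 1 else -1) else 0
  contMDiff : ContMDiff (𝓡 4) ((𝓡 4).prod 𝓘(ℝ, E4 →L[ℝ] E4 →L[ℝ] ℝ)) ∞
    (fun x : M ↦ TotalSpace.mk' (E4 →L[ℝ] E4 →L[ℝ] ℝ)
      (E := fun x : M ↦ TangentSpace (𝓡 4) x →L[ℝ] TangentSpace (𝓡 4) x →L[ℝ] ℝ) x (val x))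

/-- A connection on `M`, that is, a covariant derivative on the tangent bundle:
`D v x (u x)` is the value at `x` of `D_u v`. -/
abbrev Connection : Type _ :=
  CovariantDerivative (𝓡 4) E4 (fun x : M ↦ TangentSpace (𝓡 4) x)

/-- Vector fields on `M` (without regularity). -/
abbrev VField : Type _ := ∀ x : M, TangentSpace (𝓡 4) x

end Structures

variable {M : Type*} [TopologicalSpace M] [ChartedSpace E4 M] [IsManifold (𝓡 4) ∞ M]

/-- A smooth volume form `τ` of the metric `g`, normalised by `τ · τ = -1`. In terms of
a basis `v` of the tangent space, `τ · τ = τ(v)² / det (g(v i, v j))`. -/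
structure VolumeForm (g : LorentzMetric M) where
  /-- the volume form at a point -/
  val : ∀ x : M, TangentSpace (𝓡 4) x [⋀^Fin 4]→ₗ[ℝ] ℝ
  normalized : ∀ (x : M) (v : Fin 4 → TangentSpace (𝓡 4) x),
    val x v ^ 2 = - (Matrix.of fun i j ↦ g.val x (v i) (v j)).det
  contMDiff : ∀ V : Fin 4 → VField M,
    (∀ i, ContMDiff (𝓡 4) (𝓡 4).tangent ∞ (fun x ↦ (⟨x, V i x⟩ : TangentBundle (𝓡 4) M))) →
    ContMDiff (𝓡 4) 𝓘(ℝ, ℝ) ∞ (fun x ↦ val x fun i ↦ V i x)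

/-- Metric compatibility `D g = 0`: `u (g(v, w)) = g(D_u v, w) + g(v, D_u w)`. -/
def IsMetricCompatible (g : LorentzMetric M) (D : Connection M) : Prop :=
  ∀ (x : M) (u : TangentSpace (𝓡 4) x) (v w : VField M),
    MDifferentiableAt (𝓡 4) (𝓡 4).tangent (fun y ↦ (⟨y, v y⟩ : TangentBundle (𝓡 4) M)) x →
    MDifferentiableAt (𝓡 4) (𝓡 4).tangent (fun y ↦ (⟨y, w y⟩ : TangentBundle (𝓡 4) M)) x →
      mvfderiv (𝓡 4) (fun y ↦ g.val y (v y) (w y)) x u =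
        g.val x (D v x u) (w x) + g.val x (v x) (D w x u)

/-- The curvature operation `D_u D_v w - D_v D_u w - D_[u,v] w`. -/
noncomputable def curvatureOp (D : Connection M) (u v w : VField M) : VField M :=
  fun x ↦ D (fun y ↦ D w y (v y)) x (u x) - D (fun y ↦ D w y (u y)) x (v x)
    - D w x (VectorField.mlieBracket (𝓡 4) u v x)

/-- A (smooth) moving frame on an open set of `M`. The dual coframe `θ^ρ` is `coframe`. -/
structure MovingFrame (M : Type*) [TopologicalSpace M] [ChartedSpace E4 M]
    [IsManifold (𝓡 4) ∞ M] where
  /-- the domain of the frame -/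
  dom : Set M
  isOpen_dom : IsOpen dom
  /-- the vector fields of the frame -/
  e : Fin 4 → VField M
  isLocalFrameOn : IsLocalFrameOn (𝓡 4) E4 ∞ e dom

namespace MovingFrame

variable (F : MovingFrame M)

/-- The dual frame `θ^ρ` of the frame `e_α`, with `θ^ρ(e_α) = δ^ρ_α` on the domain. -/
noncomputable def coframe (ρ : Fin 4) (x : M) : TangentSpace (𝓡 4) x →ₗ[ℝ] ℝ :=
  F.isLocalFrameOn.coeff ρ x

/-- Connection coefficients: `D_{e_α} e_β = L^ρ_{αβ} e_ρ`; `connCoeff D α β ρ` is `L^ρ_{αβ}`. -/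
noncomputable def connCoeff (D : Connection M) (α β ρ : Fin 4) (x : M) : ℝ :=
  F.coframe ρ x (D (F.e β) x (F.e α x))

/-- Components `g_{μν}` of the metric. -/
noncomputable def metric (g : LorentzMetric M) (μ ν : Fin 4) (x : M) : ℝ :=
  g.val x (F.e μ x) (F.e ν x)

/-- Components `g^{μν}` of the metric on covectors. -/
noncomputable def metricInv (g : LorentzMetric M) (μ ν : Fin 4) (x : M) : ℝ :=
  (Matrix.of fun α β ↦ F.metric g α β x)⁻¹ μ ν

/-- Components `ε_{μνρσ} = τ(e_μ, e_ν, e_ρ, e_σ)` of the volume form. In a positively oriented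
frame this is `√|det g|` times the Levi-Civita symbol. -/
noncomputable def vol {g : LorentzMetric M} (τ : VolumeForm g) (μ ν ρ σ : Fin 4) (x : M) : ℝ :=
  τ.val x ![F.e μ x, F.e ν x, F.e ρ x, F.e σ x]

/-- Torsion components: the torsion 2-form is `𝓣^ρ = ½ T^ρ_{αβ} θ^α ∧ θ^β`, and
`torsion D ρ α β` is `T^ρ_{αβ} = θ^ρ(D_{e_α} e_β - D_{e_β} e_α - [e_α, e_β])`. -/
noncomputable def torsion (D : Connection M) (ρ α β : Fin 4) (x : M) : ℝ :=
  F.coframe ρ x (D.torsion x (F.e α x) (F.e β x))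

/-- Curvature components: the curvature 2-form is `𝓡^ρ_μ = ½ R_μ^ρ_{αβ} θ^α ∧ θ^β`, and
`curvature D μ ρ α β` is `R_μ^ρ_{αβ}`, i.e. `θ^ρ` of the curvature operation on
`(e_α, e_β, e_μ)`. -/
noncomputable def curvature (D : Connection M) (μ ρ α β : Fin 4) (x : M) : ℝ :=
  F.coframe ρ x (curvatureOp D (F.e α) (F.e β) (F.e μ) x)

/-- Hodge dual of the 2-form `½ B_{αβ} θ^α ∧ θ^β`, in components:
`(⋆B)_{λσ} = ½ g^{ακ} g^{βι} B_{αβ} ε_{κιλσ}`. -/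
noncomputable def hodge {g : LorentzMetric M} (τ : VolumeForm g) (B : Fin 4 → Fin 4 → M → ℝ)
    (l s : Fin 4) (x : M) : ℝ :=
  (1 / 2) * ∑ α, ∑ β, ∑ κ, ∑ ι,
    F.metricInv g α κ x * F.metricInv g β ι x * B α β x * F.vol τ κ ι l s x

/-- Components `R_{μν} = R_μ^ρ_{ρν}` of the Ricci tensor. -/
noncomputable def ricci (D : Connection M) (μ ν : Fin 4) (x : M) : ℝ :=
  ∑ ρ, F.curvature D μ ρ ρ ν x

/-- The curvature scalar `R = g^{μν} R_{μν}`. -/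
noncomputable def scalar (g : LorentzMetric M) (D : Connection M) (x : M) : ℝ :=
  ∑ μ, ∑ ν, F.metricInv g μ ν x * F.ricci D μ ν x

/-- Components `G_{μν} = R_{μν} - ½ g_{μν} R` of the Einstein tensor. -/
noncomputable def einstein (g : LorentzMetric M) (D : Connection M) (μ ν : Fin 4) (x : M) : ℝ :=
  F.ricci D μ ν x - (1 / 2) * F.metric g μ ν x * F.scalar g D x

/-- Mixed components `S_μ^κ = S_{μν} g^{νκ}` of a tensor field of type `(0,2)`. -/
noncomputable def mixed (g : LorentzMetric M)
    (S : ∀ x : M, TangentSpace (𝓡 4) x →L[ℝ] TangentSpace (𝓡 4) x →L[ℝ] ℝ)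
    (μ κ : Fin 4) (x : M) : ℝ :=
  ∑ ν, S x (F.e μ x) (F.e ν x) * F.metricInv g ν κ x

/-- The trace `S_κ^κ` of a tensor field of type `(0,2)`. -/
noncomputable def trace (g : LorentzMetric M)
    (S : ∀ x : M, TangentSpace (𝓡 4) x →L[ℝ] TangentSpace (𝓡 4) x →L[ℝ] ℝ) (x : M) : ℝ :=
  ∑ κ, F.mixed g S κ κ x

/-- `lower₃ g S ρ α β` is `S_{ραβ} = g_{ρσ} S^σ_{αβ}`. -/
noncomputable def lower₃ (g : LorentzMetric M) (S : Fin 4 → Fin 4 → Fin 4 → M → ℝ)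
    (ρ α β : Fin 4) (x : M) : ℝ :=
  ∑ σ, F.metric g ρ σ x * S σ α β x

/-- `lower₄ g S μ ρ α β` is `S_{μραβ} = g_{ρσ} S_μ^σ_{αβ}`. -/
noncomputable def lower₄ (g : LorentzMetric M) (S : Fin 4 → Fin 4 → Fin 4 → Fin 4 → M → ℝ)
    (μ ρ α β : Fin 4) (x : M) : ℝ :=
  ∑ σ, F.metric g ρ σ x * S μ σ α β x

/-- Components `D_μ S_{ραβ}` of the covariant derivative of a tensor of type `(0,3)`. -/
noncomputable def covDeriv₃ (D : Connection M) (S : Fin 4 → Fin 4 → Fin 4 → M → ℝ)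
    (μ ρ α β : Fin 4) (x : M) : ℝ :=
  mvfderiv (𝓡 4) (S ρ α β) x (F.e μ x)
    - ∑ σ, (F.connCoeff D μ ρ σ x * S σ α β x + F.connCoeff D μ α σ x * S ρ σ β x
      + F.connCoeff D μ β σ x * S ρ α σ x)

/-- Components `D_μ S_{βανρ}` of the covariant derivative of a tensor of type `(0,4)`. -/
noncomputable def covDeriv₄ (D : Connection M) (S : Fin 4 → Fin 4 → Fin 4 → Fin 4 → M → ℝ)
    (μ β α ν ρ : Fin 4) (x : M) : ℝ :=
  mvfderiv (𝓡 4) (S β α ν ρ) x (F.e μ x)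
    - ∑ σ, (F.connCoeff D μ β σ x * S σ α ν ρ x + F.connCoeff D μ α σ x * S β σ ν ρ x
      + F.connCoeff D μ ν σ x * S β α σ ρ x + F.connCoeff D μ ρ σ x * S β α ν σ x)

/-- Components `(⋆T)^ρ_{αβ}` of the Hodge duals `⋆𝓣^ρ` of the torsion 2-forms. -/
noncomputable def dualTorsion {g : LorentzMetric M} (τ : VolumeForm g) (D : Connection M)
    (ρ α β : Fin 4) (x : M) : ℝ :=
  F.hodge τ (F.torsion D ρ) α β x

/-- Components `(⋆R)_μ^ρ_{αβ}` of the Hodge duals `⋆𝓡^ρ_μ` of the curvature 2-forms. -/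
noncomputable def dualCurvature {g : LorentzMetric M} (τ : VolumeForm g) (D : Connection M)
    (μ ρ α β : Fin 4) (x : M) : ℝ :=
  F.hodge τ (F.curvature D μ ρ) α β x

/-- The scalar `R* = g^{μβ} (⋆R)_μ^ρ_{ρβ}` formed with the dual curvature. -/
noncomputable def dualScalar {g : LorentzMetric M} (τ : VolumeForm g) (D : Connection M)
    (x : M) : ℝ :=
  ∑ μ, ∑ β, F.metricInv g μ β x * ∑ ρ, F.dualCurvature τ D μ ρ ρ β x

/-- The right-hand side of the first Bianchi identity: the sum over the cyclic permutations of
`(μ, α, β)` of `D_μ T_{ραβ} - T^κ_{μβ} T_{ρκα}`. -/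
noncomputable def bianchiSum (g : LorentzMetric M) (D : Connection M)
    (T : Fin 4 → Fin 4 → Fin 4 → M → ℝ) (ρ μ α β : Fin 4) (x : M) : ℝ :=
  let t : Fin 4 → Fin 4 → Fin 4 → ℝ := fun μ α β ↦
    F.covDeriv₃ D (F.lower₃ g T) μ ρ α β x - ∑ κ, T κ μ β x * F.lower₃ g T ρ κ α x
  t μ α β + t α β μ + t β μ α

end MovingFrame

/-- The torsion and curvature 2-forms of `D'` are the Hodge duals of those of `D`:
`𝓣'^ρ = ⋆𝓣^ρ` and `𝓡'^ρ_μ = ⋆𝓡^ρ_μ` in every moving frame. -/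
structure IsDualConnection {g : LorentzMetric M} (τ : VolumeForm g) (D D' : Connection M) :
    Prop where
  torsion_eq : ∀ (F : MovingFrame M), ∀ x ∈ F.dom, ∀ ρ α β,
    F.torsion D' ρ α β x = F.dualTorsion τ D ρ α β x
  curvature_eq : ∀ (F : MovingFrame M), ∀ x ∈ F.dom, ∀ μ ρ α β,
    F.curvature D' μ ρ α β x = F.dualCurvature τ D μ ρ α β x

/-- The Einstein(-like) equation `G_{μν} = S_{μν}` for the metric `g`, the connection `D` and the
energy-momentum tensor `S`. -/
def EinsteinEquation (g : LorentzMetric M) (D : Connection M)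
    (S : ∀ x : M, TangentSpace (𝓡 4) x →L[ℝ] TangentSpace (𝓡 4) x →L[ℝ] ℝ) : Prop :=
  ∀ (F : MovingFrame M), ∀ x ∈ F.dom, ∀ μ ν, F.einstein g D μ ν x = S x (F.e μ x) (F.e ν x)

end RiemannCartan

/-!
All tensors are expanded in a moving frame `e_α` with structure functions
`c^κ_{αβ} = θ^κ([e_α, e_β])`, and the two Bianchi identities are proved there from the Jacobi
identity for the frame. With the matrices `A_α` of connection coefficients and `Ω_{αβ}` of curvature
components, the structure equation reads
`Ω_{αβ} = ∂_α A_β - ∂_β A_α + [A_α, A_β] - c^κ_{αβ} A_κ` (`curvMatrix_eq`), and frame derivatives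
satisfy `[∂_α, ∂_β] = c^κ_{αβ} ∂_κ` (`frameDeriv_comm`).

For a metric connection `D` the right-hand side of the first Bianchi identity equals the cyclic sum
of `R_{μραβ}` over `(μ, α, β)` (`bianchiSum_torsion`). Applied to `D'` this is the cyclic sum of the
dual curvature `⋆R`. Since `R` is skew in both pairs of indices, that cyclic sum is
`-ε_{μαβκ} R_ρ^κ`: antisymmetrising over five indices in dimension four gives zero
(`cyclic_sum_dual`, `sum_lower₄_dualCurvature`). Einstein's equation expresses the Ricci tensor by
the energy-momentum tensor (`sum_vol_mixed`), which gives the equation for `D'`. As `⋆⋆ = -1` in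
Lorentzian signature (`hodgeMatrix_hodgeMatrix`), the curvature of `D` is minus the dual of that of
`D'`, and the same argument with the two connections exchanged gives the equation for `D`, with the
opposite sign.

If `D` is torsion free, so is `D'`, because its torsion 2-forms are the duals of zero. Then the
right sides of both equations vanish, and the trace of Einstein's equation turns `R` into `-T_κ^κ`
(`trace_eq_neg_scalar`). The last equality holds because both of its sides are zero, by the second
Bianchi identity of a torsion-free metric connection (`sum_covDeriv₄_curvature`).
-/

namespace RiemannCartan

open VectorField

/-! ### Smoothness of metrics and covariant derivatives -/

section Smoothness

variable {M : Type*} [TopologicalSpace M] [ChartedSpace E4 M]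

lemma contMDiffAt_det {A : M → Matrix (Fin 4) (Fin 4) ℝ} {x : M}
    (hA : ∀ i j, ContMDiffAt (𝓡 4) 𝓘(ℝ, ℝ) ∞ (fun y ↦ A y i j) x) :
    ContMDiffAt (𝓡 4) 𝓘(ℝ, ℝ) ∞ (fun y ↦ (A y).det) x := by
  simp only [Matrix.det_apply']
  exact ContMDiffAt.sum fun σ _ ↦ contMDiffAt_const.mul (ContMDiffAt.prod fun i _ ↦ hA _ _)

lemma contMDiffAt_matrix_inv {A : M → Matrix (Fin 4) (Fin 4) ℝ} {x : M}
    (hA : ∀ i j, ContMDiffAt (𝓡 4) 𝓘(ℝ, ℝ) ∞ (fun y ↦ A y i j) x) (h0 : (A x).det ≠ 0)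
    (i j : Fin 4) : ContMDiffAt (𝓡 4) 𝓘(ℝ, ℝ) ∞ (fun y ↦ (A y)⁻¹ i j) x := by
  have h : (fun y ↦ (A y)⁻¹ i j) = fun y ↦ ((A y).det)⁻¹ * (A y).adjugate i j := by
    funext y
    simp [Matrix.inv_def]
  rw [h]
  refine ((contMDiffAt_det hA).inv₀ h0).mul ?_
  simp only [Matrix.adjugate_apply]
  refine contMDiffAt_det fun k l ↦ ?_
  by_cases hk : k = j
  · subst hk
    simpa using contMDiffAt_const
  · simpa [Matrix.updateRow_ne hk] using hA k l

variable [IsManifold (𝓡 4) ∞ M]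

/-- Smoothness of a vector field at a point, as a section of the tangent bundle. -/
abbrev SmoothVFieldAt (V : VField M) (x : M) : Prop :=
  ContMDiffAt (𝓡 4) (𝓡 4).tangent ∞ (fun y ↦ (⟨y, V y⟩ : TangentBundle (𝓡 4) M)) x

lemma LorentzMetric.contMDiffAt_apply (g : LorentzMetric M) {V W : VField M} {x : M}
    (hV : SmoothVFieldAt V x) (hW : SmoothVFieldAt W x) :
    ContMDiffAt (𝓡 4) 𝓘(ℝ, ℝ) ∞ (fun y ↦ g.val y (V y) (W y)) x := by
  have : ContMDiffAt (𝓡 4) ((𝓡 4).prod 𝓘(ℝ, ℝ)) ∞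
      (fun y ↦ TotalSpace.mk' ℝ (E := Bundle.Trivial M ℝ) y (g.val y (V y) (W y))) x :=
    ContMDiffAt.clm_bundle_apply₂ (F₁ := E4) (F₂ := E4) (F₃ := ℝ)
      (E₁ := fun x : M ↦ TangentSpace (𝓡 4) x) (E₂ := fun x : M ↦ TangentSpace (𝓡 4) x)
      (E₃ := Bundle.Trivial M ℝ) g.contMDiff.contMDiffAt hV hW
  simpa [Bundle.contMDiffAt_section] using this

/-- A smooth connection maps fields that are smooth on an open set to smooth fields. As smoothness
of a connection concerns fields on the whole manifold, the field is first cut off by a bump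
function, which does not change its covariant derivative near `x`. -/
lemma contMDiffAt_covariantDerivative [T2Space M] (D : Connection M)
    [CovariantDerivative.ContMDiffCovariantDerivative D ∞] {V W : VField M} {u : Set M}
    (hu : IsOpen u) {x : M} (hx : x ∈ u) (hV : ∀ y ∈ u, SmoothVFieldAt V y)
    (hW : SmoothVFieldAt W x) :
    SmoothVFieldAt (fun y ↦ D V y (W y)) x := by
  obtain ⟨ψ, -, hψ⟩ := (SmoothBumpFunction.nhds_basis_tsupport (I := 𝓡 4) x).mem_iff.1
    (hu.mem_nhds hx)
  have hψV : ∀ y, SmoothVFieldAt ((ψ : M → ℝ) • V) y :=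
    ContMDiffOn.smul_section_of_tsupport ψ.contMDiff.contMDiffOn hu hψ
      fun y hy ↦ (hV y hy).contMDiffWithinAt
  have hD := (CovariantDerivative.ContMDiffCovariantDerivative.contMDiff
    (cov := D) (k := ∞)).contMDiff (σ := (ψ : M → ℝ) • V) (fun y _ ↦ (hψV y).contMDiffWithinAt)
  have hDW : SmoothVFieldAt (fun y ↦ D ((ψ : M → ℝ) • V) y (W y)) x :=
    ContMDiffAt.clm_bundle_apply (F₁ := E4) (F₂ := E4)
      (E₁ := fun x : M ↦ TangentSpace (𝓡 4) x) (E₂ := fun x : M ↦ TangentSpace (𝓡 4) x)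
      (hD.contMDiffAt Filter.univ_mem) hW
  refine hDW.congr_of_eventuallyEq ?_
  filter_upwards [ψ.eventuallyEq_one.eventuallyEq_nhds, hu.mem_nhds hx] with y hy hyu
  have : D V y = D ((ψ : M → ℝ) • V) y := by
    refine D.isCovariantDerivativeOn.congr_of_eventuallyEq (s := Set.univ)
      ((hV y hyu).mdifferentiableAt (by simp))
      ((hψV y).mdifferentiableAt (by simp)) Filter.univ_mem ?_
    filter_upwards [hy] with z hz
    simp [hz]
  simp [this]

end Smoothness

/-! ### Components in a moving frame -/

namespace MovingFrame

variable {M : Type*} [TopologicalSpace M] [ChartedSpace E4 M] [IsManifold (𝓡 4) ∞ M]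
variable (F : MovingFrame M)

lemma contMDiffAt_e {x : M} (hx : x ∈ F.dom) (i : Fin 4) : SmoothVFieldAt (F.e i) x :=
  F.isLocalFrameOn.contMDiffAt F.isOpen_dom hx i

lemma mdifferentiableAt_e {x : M} (hx : x ∈ F.dom) (i : Fin 4) : 
    MDifferentiableAt (𝓡 4) (𝓡 4).tangent
      (fun y ↦ (⟨y, F.e i y⟩ : TangentBundle (𝓡 4) M)) x :=
  (F.contMDiffAt_e hx i).mdifferentiableAt (by simp)

/-- The basis of the tangent space at a point of the domain formed by the frame. -/
noncomputable def basisAt {x : M} (hx : x ∈ F.dom) :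
    Module.Basis (Fin 4) ℝ (TangentSpace (𝓡 4) x) :=
  F.isLocalFrameOn.toBasisAt hx

lemma basisAt_apply {x : M} (hx : x ∈ F.dom) (i : Fin 4) : F.basisAt hx i = F.e i x :=
  F.isLocalFrameOn.toBasisAt_coe hx i

lemma coframe_eq {x : M} (hx : x ∈ F.dom) (ρ : Fin 4) (v : TangentSpace (𝓡 4) x) :
    F.coframe ρ x v = (F.basisAt hx).repr v ρ := by
  simp [coframe, basisAt, IsLocalFrameOn.coeff, hx]

lemma sum_coframe_smul {x : M} (hx : x ∈ F.dom) (v : TangentSpace (𝓡 4) x) :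
    v = ∑ ρ, F.coframe ρ x v • F.e ρ x := by
  simpa [F.coframe_eq hx, F.basisAt_apply hx] using ((F.basisAt hx).sum_repr v).symm

lemma coframe_e {x : M} (hx : x ∈ F.dom) (ρ α : Fin 4) :
    F.coframe ρ x (F.e α x) = if α = ρ then 1 else 0 := by
  rw [F.coframe_eq hx, ← F.basisAt_apply hx, Module.Basis.repr_self, Finsupp.single_apply]

/-- The Gram matrix `g_{μν}` of the frame. -/
noncomputable def gram (g : LorentzMetric M) (x : M) : Matrix (Fin 4) (Fin 4) ℝ :=
  Matrix.of fun α β ↦ F.metric g α β x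

/-- A volume form does not vanish on a frame: otherwise it would vanish identically, while on an
orthonormal basis `τ² = -det (diag (1, -1, -1, -1)) = 1`. -/
lemma volume_frame_ne_zero {g : LorentzMetric M} (τ : VolumeForm g) {x : M} (hx : x ∈ F.dom) :
    τ.val x (F.basisAt hx) ≠ 0 := by
  intro h
  obtain ⟨b, hb⟩ := g.signature x
  have h1 := τ.normalized x b
  rw [AlternatingMap.eq_smul_basis_det (F.basisAt hx) (τ.val x), h] at h1
  have h2 : (Matrix.of fun i j ↦ g.val x (b i) (b j))
      = Matrix.diagonal fun i : Fin 4 ↦ if i = 0 then (1 : ℝ) else -1 := by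
    ext i j
    simp [hb, Matrix.diagonal_apply]
  rw [h2, Matrix.det_diagonal] at h1
  simp [Fin.prod_univ_four] at h1

lemma sq_volume_frame {g : LorentzMetric M} (τ : VolumeForm g) {x : M} (hx : x ∈ F.dom) :
    τ.val x (F.basisAt hx) ^ 2 = -(F.gram g x).det := by
  rw [τ.normalized]
  simp [gram, metric, F.basisAt_apply hx]

lemma det_gram_ne_zero {g : LorentzMetric M} (τ : VolumeForm g) {x : M} (hx : x ∈ F.dom) :
    (F.gram g x).det ≠ 0 := by
  intro h
  have := F.sq_volume_frame τ hx
  rw [h, neg_zero] at this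
  exact F.volume_frame_ne_zero τ hx (pow_eq_zero_iff two_ne_zero |>.1 this)

lemma gram_transpose (g : LorentzMetric M) (x : M) : (F.gram g x).transpose = F.gram g x := by
  ext i j
  exact g.symm x _ _

lemma contMDiffAt_metric (g : LorentzMetric M) {x : M} (hx : x ∈ F.dom) (μ ν : Fin 4) :
    ContMDiffAt (𝓡 4) 𝓘(ℝ, ℝ) ∞ (F.metric g μ ν) x :=
  g.contMDiffAt_apply (F.contMDiffAt_e hx μ) (F.contMDiffAt_e hx ν)

/-- The components of a smooth vector field are smooth, because `θ^ρ(V) = g^{ρσ} g(e_σ, V)`. -/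
lemma contMDiffAt_coframe {g : LorentzMetric M} (τ : VolumeForm g) {x : M} (hx : x ∈ F.dom)
    {V : VField M} (hV : SmoothVFieldAt V x) (ρ : Fin 4) :
    ContMDiffAt (𝓡 4) 𝓘(ℝ, ℝ) ∞ (fun y ↦ F.coframe ρ y (V y)) x := by
  have h : ContMDiffAt (𝓡 4) 𝓘(ℝ, ℝ) ∞
      (fun y ↦ ∑ σ, (F.gram g y)⁻¹ ρ σ * g.val y (F.e σ y) (V y)) x :=
    ContMDiffAt.sum fun σ _ ↦
      (contMDiffAt_matrix_inv (fun i j ↦ F.contMDiffAt_metric g hx i j)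
        (F.det_gram_ne_zero τ hx) ρ σ).mul (g.contMDiffAt_apply (F.contMDiffAt_e hx σ) hV)
  refine h.congr_of_eventuallyEq ?_
  filter_upwards [F.isOpen_dom.mem_nhds hx] with y hy
  have h1 : ∀ σ, g.val y (F.e σ y) (V y)
      = ((F.gram g y).mulVec fun κ ↦ F.coframe κ y (V y)) σ := by
    intro σ
    conv_lhs => rw [F.sum_coframe_smul hy (V y)]
    simp [Matrix.mulVec, dotProduct, gram, metric, mul_comm]
  have h2 : (fun κ ↦ F.coframe κ y (V y))
      = (F.gram g y)⁻¹.mulVec ((F.gram g y).mulVec fun κ ↦ F.coframe κ y (V y)) := by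
    rw [Matrix.mulVec_mulVec, Matrix.nonsing_inv_mul _ (F.det_gram_ne_zero τ hy).isUnit,
      Matrix.one_mulVec]
  simp only [h1]
  exact congrFun h2 ρ

/-- The structure functions `c^κ_{αβ} = θ^κ([e_α, e_β])` of the frame;
`structureFun α β κ` is `c^κ_{αβ}`. -/
noncomputable def structureFun (α β κ : Fin 4) (x : M) : ℝ :=
  F.coframe κ x (mlieBracket (𝓡 4) (F.e α) (F.e β) x)

lemma contMDiffAt_mlieBracket {V W : VField M} {x : M}
    (hV : SmoothVFieldAt V x) (hW : SmoothVFieldAt W x) :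
    SmoothVFieldAt (mlieBracket (𝓡 4) V W) x := by
  have : IsManifold (𝓡 4) (((⊤ : ℕ∞) : ℕ∞ω) + 1) M := inferInstanceAs (IsManifold (𝓡 4) ∞ M)
  have : IsManifold (𝓡 4) (minSmoothness ℝ 2) M := by
    rw [minSmoothness_of_isRCLikeNormedField]
    infer_instance
  exact ContMDiffAt.mlieBracket_vectorField (m := ⊤) (n := ⊤) hV hW (by simp)

lemma contMDiffAt_structureFun {g : LorentzMetric M} (τ : VolumeForm g) {x : M} (hx : x ∈ F.dom)
    (α β κ : Fin 4) : ContMDiffAt (𝓡 4) 𝓘(ℝ, ℝ) ∞ (F.structureFun α β κ) x :=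
  F.contMDiffAt_coframe τ hx
    (contMDiffAt_mlieBracket (F.contMDiffAt_e hx α) (F.contMDiffAt_e hx β)) κ

lemma contMDiffAt_connCoeff [T2Space M] {g : LorentzMetric M} (τ : VolumeForm g)
    (D : Connection M) [CovariantDerivative.ContMDiffCovariantDerivative D ∞]
    {x : M} (hx : x ∈ F.dom) (α β ρ : Fin 4) :
    ContMDiffAt (𝓡 4) 𝓘(ℝ, ℝ) ∞ (F.connCoeff D α β ρ) x :=
  F.contMDiffAt_coframe τ hx (contMDiffAt_covariantDerivative D F.isOpen_dom hx
    (fun _ hy ↦ F.contMDiffAt_e hy β) (F.contMDiffAt_e hx α)) ρ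

end MovingFrame

/-! ### Derivatives along a moving frame -/

namespace MovingFrame

variable {M : Type*} [TopologicalSpace M] [ChartedSpace E4 M] [IsManifold (𝓡 4) ∞ M]
variable (F : MovingFrame M)

/-- Smoothness of a function at every point of the domain of the frame. -/
def SmoothFun (f : M → ℝ) : Prop := ∀ y ∈ F.dom, ContMDiffAt (𝓡 4) 𝓘(ℝ, ℝ) ∞ f y

/-- The derivative `e_α f` of a function along a vector field of the frame. -/
noncomputable def frameDeriv (α : Fin 4) (f : M → ℝ) (x : M) : ℝ :=
  mvfderiv (𝓡 4) f x (F.e α x)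

variable {F}

namespace SmoothFun

variable {f h : M → ℝ}

lemma mdiff (hf : F.SmoothFun f) {x : M} (hx : x ∈ F.dom) :
    MDifferentiableAt (𝓡 4) 𝓘(ℝ, ℝ) f x :=
  (hf x hx).mdifferentiableAt (by simp)

lemma add (hf : F.SmoothFun f) (hh : F.SmoothFun h) : F.SmoothFun fun y ↦ f y + h y :=
  fun y hy ↦ (hf y hy).add (hh y hy)

lemma sub (hf : F.SmoothFun f) (hh : F.SmoothFun h) : F.SmoothFun fun y ↦ f y - h y :=
  fun y hy ↦ (hf y hy).sub (hh y hy)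

lemma mul (hf : F.SmoothFun f) (hh : F.SmoothFun h) : F.SmoothFun fun y ↦ f y * h y :=
  fun y hy ↦ (hf y hy).mul (hh y hy)

lemma sum {f : Fin 4 → M → ℝ} (hf : ∀ i, F.SmoothFun (f i)) : F.SmoothFun fun y ↦ ∑ i, f i y :=
  fun y hy ↦ ContMDiffAt.sum fun i _ ↦ hf i y hy

lemma congr (hf : F.SmoothFun f) (hfh : ∀ y ∈ F.dom, h y = f y) : F.SmoothFun h :=
  fun y hy ↦ (hf y hy).congr_of_eventuallyEq
    (Filter.eventuallyEq_of_mem (F.isOpen_dom.mem_nhds hy) hfh)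

end SmoothFun

section frameDeriv

variable {f h : M → ℝ} {x : M}

lemma frameDeriv_congr (hfh : ∀ y ∈ F.dom, f y = h y) (hx : x ∈ F.dom) (α : Fin 4) :
    F.frameDeriv α f x = F.frameDeriv α h x := by
  have := (Filter.eventuallyEq_of_mem (F.isOpen_dom.mem_nhds hx) hfh).mfderiv_eq
    (I := 𝓡 4) (I' := 𝓘(ℝ, ℝ))
  simp only [frameDeriv, mvfderiv, ContinuousLinearMap.comp_apply]
  rw [this]
  rfl

lemma frameDeriv_add (hf : F.SmoothFun f) (hh : F.SmoothFun h) (hx : x ∈ F.dom) (α : Fin 4) :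
    F.frameDeriv α (fun y ↦ f y + h y) x = F.frameDeriv α f x + F.frameDeriv α h x := by
  simp [frameDeriv, mvfderiv_fun_add (hf.mdiff hx) (hh.mdiff hx)]

lemma frameDeriv_sub (hf : F.SmoothFun f) (hh : F.SmoothFun h) (hx : x ∈ F.dom) (α : Fin 4) :
    F.frameDeriv α (fun y ↦ f y - h y) x = F.frameDeriv α f x - F.frameDeriv α h x := by
  simp [frameDeriv, mvfderiv_fun_sub (hf.mdiff hx) (hh.mdiff hx)]

lemma frameDeriv_mul (hf : F.SmoothFun f) (hh : F.SmoothFun h) (hx : x ∈ F.dom) (α : Fin 4) :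
    F.frameDeriv α (fun y ↦ f y * h y) x
      = F.frameDeriv α f x * h x + f x * F.frameDeriv α h x := by
  simp [frameDeriv, mvfderiv_fun_mul (hf.mdiff hx) (hh.mdiff hx)]
  ring

lemma frameDeriv_sum {f : Fin 4 → M → ℝ} (hf : ∀ i, F.SmoothFun (f i)) (hx : x ∈ F.dom)
    (α : Fin 4) : F.frameDeriv α (fun y ↦ ∑ i, f i y) x = ∑ i, F.frameDeriv α (f i) x := by
  simp only [Fin.sum_univ_four]
  rw [frameDeriv_add (((hf 0).add (hf 1)).add (hf 2)) (hf 3) hx,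
    frameDeriv_add ((hf 0).add (hf 1)) (hf 2) hx, frameDeriv_add (hf 0) (hf 1) hx]

/-- `[V, f W] = (V f) W + f [V, W]`, with `V` a vector field of the frame. -/
lemma mlieBracket_e_smul (hf : F.SmoothFun f) (hx : x ∈ F.dom) {W : VField M}
    (hW : SmoothVFieldAt W x) (α : Fin 4) :
    mlieBracket (𝓡 4) (F.e α) (f • W) x
      = F.frameDeriv α f x • W x + f x • mlieBracket (𝓡 4) (F.e α) W x :=
  mlieBracket_smul_right (hf.mdiff hx) (hW.mdifferentiableAt (by simp))

/-- Derivatives of smooth functions along the frame are smooth: `e_α f` is the first component of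
the vector field `[e_α, f e_0] - f [e_α, e_0]`. -/
lemma SmoothFun.frameDeriv {g : LorentzMetric M} (τ : VolumeForm g) (hf : F.SmoothFun f)
    (α : Fin 4) : F.SmoothFun (F.frameDeriv α f) := by
  have h1 : F.SmoothFun fun y ↦ F.coframe 0 y (mlieBracket (𝓡 4) (F.e α) (f • F.e 0) y)
      - f y * F.structureFun α 0 0 y := by
    refine SmoothFun.sub (fun y hy ↦ F.contMDiffAt_coframe τ hy
      (contMDiffAt_mlieBracket (F.contMDiffAt_e hy α) ?_) 0)
      (hf.mul fun y hy ↦ F.contMDiffAt_structureFun τ hy α 0 0)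
    exact (hf y hy).smul_section (F.contMDiffAt_e hy 0)
  refine h1.congr fun y hy ↦ ?_
  rw [mlieBracket_e_smul hf hy (F.contMDiffAt_e hy 0)]
  simp [F.coframe_e hy, structureFun]

lemma smoothFun_structureFun {g : LorentzMetric M} (τ : VolumeForm g) (α β κ : Fin 4) :
    F.SmoothFun (F.structureFun α β κ) :=
  fun _ hy ↦ F.contMDiffAt_structureFun τ hy α β κ

lemma mlieBracket_e (hx : x ∈ F.dom) (α β : Fin 4) :
    mlieBracket (𝓡 4) (F.e α) (F.e β) x = ∑ κ, F.structureFun α β κ x • F.e κ x :=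
  F.sum_coframe_smul hx _

lemma structureFun_antisymm (α β κ : Fin 4) (x : M) :
    F.structureFun α β κ x = -F.structureFun β α κ x := by
  rw [structureFun, mlieBracket_swap]
  simp [structureFun]

lemma leibniz_mlieBracket {U V W : VField M} (hU : SmoothVFieldAt U x) (hV : SmoothVFieldAt V x)
    (hW : SmoothVFieldAt W x) :
    mlieBracket (𝓡 4) U (mlieBracket (𝓡 4) V W) x
      = mlieBracket (𝓡 4) (mlieBracket (𝓡 4) U V) W x
        + mlieBracket (𝓡 4) V (mlieBracket (𝓡 4) U W) x := by
  have hle : minSmoothness ℝ 2 ≤ (∞ : ℕ∞ω) := by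
    rw [minSmoothness_of_isRCLikeNormedField]
    exact ENat.LEInfty.out
  have : IsManifold (𝓡 4) (minSmoothness ℝ 3) M := by
    rw [minSmoothness_of_isRCLikeNormedField]
    infer_instance
  exact leibniz_identity_mlieBracket_apply (hU.of_le hle) (hV.of_le hle) (hW.of_le hle)

/-- `[e_α, [e_β, f W]]` expanded by the Leibniz rule. -/
lemma mlieBracket_mlieBracket_smul {g : LorentzMetric M} (τ : VolumeForm g) (hf : F.SmoothFun f)
    (hx : x ∈ F.dom) {W : VField M} (hW : ∀ y ∈ F.dom, SmoothVFieldAt W y) (α β : Fin 4) :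
    mlieBracket (𝓡 4) (F.e α) (mlieBracket (𝓡 4) (F.e β) (f • W)) x
      = F.frameDeriv α (F.frameDeriv β f) x • W x
        + F.frameDeriv β f x • mlieBracket (𝓡 4) (F.e α) W x
        + F.frameDeriv α f x • mlieBracket (𝓡 4) (F.e β) W x
        + f x • mlieBracket (𝓡 4) (F.e α) (mlieBracket (𝓡 4) (F.e β) W) x := by
  have h1 : mlieBracket (𝓡 4) (F.e β) (f • W)
      =ᶠ[𝓝 x] F.frameDeriv β f • W + f • mlieBracket (𝓡 4) (F.e β) W := by
    filter_upwards [F.isOpen_dom.mem_nhds hx] with y hy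
    exact mlieBracket_e_smul hf hy (hW y hy) β
  have hβW := contMDiffAt_mlieBracket (F.contMDiffAt_e hx β) (hW x hx)
  have hβf := hf.frameDeriv τ β
  rw [Filter.EventuallyEq.rfl.mlieBracket_vectorField_eq h1, mlieBracket_add_right,
    mlieBracket_e_smul hβf hx (hW x hx), mlieBracket_e_smul hf hx hβW]
  · module
  · exact ((hβf x hx).smul_section (hW x hx)).mdifferentiableAt (by simp)
  · exact ((hf x hx).smul_section hβW).mdifferentiableAt (by simp)

/-- The commutator of two frame derivatives is the derivative along the bracket. It follows from
the Jacobi identity for `e_α`, `e_β`, `f e_0` and for `e_α`, `e_β`, `e_0`. -/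
lemma frameDeriv_comm {g : LorentzMetric M} (τ : VolumeForm g) (hf : F.SmoothFun f)
    (hx : x ∈ F.dom) (α β : Fin 4) :
    F.frameDeriv α (F.frameDeriv β f) x - F.frameDeriv β (F.frameDeriv α f) x
      = ∑ κ, F.structureFun α β κ x * F.frameDeriv κ f x := by
  have hW : ∀ y ∈ F.dom, SmoothVFieldAt (F.e 0) y := fun y hy ↦ F.contMDiffAt_e hy 0
  have hα := F.contMDiffAt_e hx α
  have hβ := F.contMDiffAt_e hx β
  have h1 := leibniz_mlieBracket hα hβ ((hf x hx).smul_section (hW x hx))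
  have h2 := leibniz_mlieBracket hα hβ (hW x hx)
  rw [mlieBracket_mlieBracket_smul τ hf hx hW, mlieBracket_mlieBracket_smul τ hf hx hW,
    mlieBracket_smul_right (hf.mdiff hx) ((hW x hx).mdifferentiableAt (by simp)), h2] at h1
  have h3 : mvfderiv (𝓡 4) f x (mlieBracket (𝓡 4) (F.e α) (F.e β) x)
      = ∑ κ, F.structureFun α β κ x * F.frameDeriv κ f x := by
    rw [mlieBracket_e hx]
    simp [frameDeriv]
  rw [h3] at h1
  have h4 := congrArg (F.coframe 0 x) h1
  simp only [map_add, map_smul, F.coframe_e hx, smul_eq_mul, if_true] at h4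
  linarith

/-- The Jacobi identity for the frame in terms of the structure functions. -/
lemma jacobi_structureFun {g : LorentzMetric M} (τ : VolumeForm g) (hx : x ∈ F.dom)
    (μ α β ρ : Fin 4) :
    (F.frameDeriv μ (F.structureFun α β ρ) x
        + ∑ σ, F.structureFun α β σ x * F.structureFun μ σ ρ x)
      + (F.frameDeriv α (F.structureFun β μ ρ) x
        + ∑ σ, F.structureFun β μ σ x * F.structureFun α σ ρ x)
      + (F.frameDeriv β (F.structureFun μ α ρ) x
        + ∑ σ, F.structureFun μ α σ x * F.structureFun β σ ρ x) = 0 := by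
  have key : ∀ μ α β, F.coframe ρ x
      (mlieBracket (𝓡 4) (F.e μ) (mlieBracket (𝓡 4) (F.e α) (F.e β)) x)
      = F.frameDeriv μ (F.structureFun α β ρ) x
        + ∑ σ, F.structureFun α β σ x * F.structureFun μ σ ρ x := by
    intro μ α β
    have h1 : mlieBracket (𝓡 4) (F.e α) (F.e β)
        =ᶠ[𝓝 x] F.structureFun α β 0 • F.e 0 + F.structureFun α β 1 • F.e 1
          + F.structureFun α β 2 • F.e 2 + F.structureFun α β 3 • F.e 3 := by
      filter_upwards [F.isOpen_dom.mem_nhds hx] with y hy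
      exact (mlieBracket_e hy α β).trans (Fin.sum_univ_four _)
    have hc : ∀ σ, F.SmoothFun (F.structureFun α β σ) := fun σ ↦ smoothFun_structureFun τ α β σ
    have hs : ∀ σ, SmoothVFieldAt (F.structureFun α β σ • F.e σ) x :=
      fun σ ↦ (hc σ x hx).smul_section (F.contMDiffAt_e hx σ)
    have hd : ∀ {V : VField M}, SmoothVFieldAt V x → MDifferentiableAt (𝓡 4) (𝓡 4).tangent
      (fun y ↦ (⟨y, V y⟩ : TangentBundle (𝓡 4) M)) x := fun h ↦ h.mdifferentiableAt (by simp)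
    rw [Filter.EventuallyEq.rfl.mlieBracket_vectorField_eq h1,
      mlieBracket_add_right (hd (((hs 0).add_section (hs 1)).add_section (hs 2))) (hd (hs 3)),
      mlieBracket_add_right (hd ((hs 0).add_section (hs 1))) (hd (hs 2)),
      mlieBracket_add_right (hd (hs 0)) (hd (hs 1))]
    have h2 : ∀ σ, F.coframe ρ x (mlieBracket (𝓡 4) (F.e μ) (F.structureFun α β σ • F.e σ) x)
        = F.frameDeriv μ (F.structureFun α β σ) x * (if σ = ρ then 1 else 0)
          + F.structureFun α β σ x * F.structureFun μ σ ρ x := by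
      intro σ
      rw [mlieBracket_e_smul (hc σ) hx (F.contMDiffAt_e hx σ)]
      simp [F.coframe_e hx, structureFun]
    have h3 : F.frameDeriv μ (F.structureFun α β ρ) x
        = ∑ σ, F.frameDeriv μ (F.structureFun α β σ) x * (if σ = ρ then 1 else 0) := by simp
    simp only [map_add, h2]
    rw [h3]
    simp only [Fin.sum_univ_four]
    ring
  rw [← key, ← key, ← key, ← map_add, ← map_add]
  have h := leibniz_mlieBracket (F.contMDiffAt_e hx μ) (F.contMDiffAt_e hx α)
    (F.contMDiffAt_e hx β)
  have h1 : mlieBracket (𝓡 4) (mlieBracket (𝓡 4) (F.e μ) (F.e α)) (F.e β) x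
      = -mlieBracket (𝓡 4) (F.e β) (mlieBracket (𝓡 4) (F.e μ) (F.e α)) x := by
    rw [mlieBracket_swap]; rfl
  have h2 : mlieBracket (𝓡 4) (F.e α) (mlieBracket (𝓡 4) (F.e μ) (F.e β)) x
      = -mlieBracket (𝓡 4) (F.e α) (mlieBracket (𝓡 4) (F.e β) (F.e μ)) x := by
    rw [mlieBracket_swap (V := F.e μ)]
    have := mlieBracket_const_smul_right (I := 𝓡 4) (V := F.e α) (c := (-1 : ℝ))
      ((contMDiffAt_mlieBracket (F.contMDiffAt_e hx β) (F.contMDiffAt_e hx μ)).mdifferentiableAt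
        (by simp))
    simpa using this
  rw [h, h1, h2]
  convert map_zero (F.coframe ρ x) using 2
  abel

end frameDeriv

/-! ### Connection, torsion and curvature coefficients -/

section Components

variable {x : M}

lemma smoothFun_connCoeff [T2Space M] {g : LorentzMetric M} (τ : VolumeForm g) (D : Connection M)
    [CovariantDerivative.ContMDiffCovariantDerivative D ∞] (α β ρ : Fin 4) :
    F.SmoothFun (F.connCoeff D α β ρ) :=
  fun _ hy ↦ F.contMDiffAt_connCoeff τ D hy α β ρ

lemma smoothFun_metric (g : LorentzMetric M) (μ ν : Fin 4) : F.SmoothFun (F.metric g μ ν) :=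
  fun _ hy ↦ F.contMDiffAt_metric g hy μ ν

lemma covariantDerivative_e (D : Connection M) (hx : x ∈ F.dom) (α β : Fin 4) :
    D (F.e β) x (F.e α x) = ∑ ρ, F.connCoeff D α β ρ x • F.e ρ x :=
  F.sum_coframe_smul hx _

/-- Components of `D_{e_α} V` for `V = f^σ e_σ`. -/
lemma coframe_covariantDerivative (D : Connection M) (hx : x ∈ F.dom) {V : VField M}
    {f : Fin 4 → M → ℝ} (hf : ∀ σ, F.SmoothFun (f σ))
    (hV : ∀ y ∈ F.dom, V y = ∑ σ, f σ y • F.e σ y) (α ρ : Fin 4) :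
    F.coframe ρ x (D V x (F.e α x))
      = F.frameDeriv α (f ρ) x + ∑ σ, f σ x * F.connCoeff D α σ ρ x := by
  have hs : ∀ σ, SmoothVFieldAt (f σ • F.e σ) x :=
    fun σ ↦ (hf σ x hx).smul_section (F.contMDiffAt_e hx σ)
  have hd : ∀ {V : VField M}, SmoothVFieldAt V x → MDifferentiableAt (𝓡 4) (𝓡 4).tangent
    (fun y ↦ (⟨y, V y⟩ : TangentBundle (𝓡 4) M)) x := fun h ↦ h.mdifferentiableAt (by simp)
  have h1 : ∀ᶠ y in 𝓝 x, V y
      = (f 0 • F.e 0 + f 1 • F.e 1 + f 2 • F.e 2 + f 3 • F.e 3) y := by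
    filter_upwards [F.isOpen_dom.mem_nhds hx] with y hy
    exact (hV y hy).trans (Fin.sum_univ_four _)
  have hsum := (((hs 0).add_section (hs 1)).add_section (hs 2)).add_section (hs 3)
  have hVs : SmoothVFieldAt V x := hsum.congr_of_eventuallyEq <| by
    filter_upwards [h1] with y hy
    rw [hy]
  have hD := D.isCovariantDerivativeOnUniv
  rw [D.isCovariantDerivativeOn.congr_of_eventuallyEq (s := Set.univ) (hd hVs) (hd hsum)
      Filter.univ_mem h1,
    hD.add (hd (((hs 0).add_section (hs 1)).add_section (hs 2))) (hd (hs 3)),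
    hD.add (hd ((hs 0).add_section (hs 1))) (hd (hs 2)), hD.add (hd (hs 0)) (hd (hs 1))]
  have h2 : ∀ σ, F.coframe ρ x (D (f σ • F.e σ) x (F.e α x))
      = F.frameDeriv α (f σ) x * (if σ = ρ then 1 else 0) + f σ x * F.connCoeff D α σ ρ x := by
    intro σ
    rw [hD.leibniz (F.mdifferentiableAt_e hx σ) ((hf σ).mdiff hx)]
    simp [F.coframe_e hx, connCoeff, frameDeriv, add_comm]
  have h3 : F.frameDeriv α (f ρ) x
      = ∑ σ, F.frameDeriv α (f σ) x * (if σ = ρ then 1 else 0) := by simp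
  simp only [_root_.add_apply, map_add, h2]
  rw [h3]
  simp only [Fin.sum_univ_four]
  ring

lemma torsion_eq (D : Connection M) (hx : x ∈ F.dom) (ρ α β : Fin 4) :
    F.torsion D ρ α β x
      = F.connCoeff D α β ρ x - F.connCoeff D β α ρ x - F.structureFun α β ρ x := by
  rw [torsion, D.torsion_apply (F.mdifferentiableAt_e hx α) (F.mdifferentiableAt_e hx β)]
  simp [connCoeff, structureFun]

lemma curvature_eq [T2Space M] {g : LorentzMetric M} (τ : VolumeForm g) (D : Connection M)
    [CovariantDerivative.ContMDiffCovariantDerivative D ∞] (hx : x ∈ F.dom) (μ ρ α β : Fin 4) :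
    F.curvature D μ ρ α β x
      = F.frameDeriv α (F.connCoeff D β μ ρ) x - F.frameDeriv β (F.connCoeff D α μ ρ) x
        + ∑ σ, F.connCoeff D β μ σ x * F.connCoeff D α σ ρ x
        - ∑ σ, F.connCoeff D α μ σ x * F.connCoeff D β σ ρ x
        - ∑ κ, F.structureFun α β κ x * F.connCoeff D κ μ ρ x := by
  have h : ∀ α β, F.coframe ρ x (D (fun y ↦ D (F.e μ) y (F.e β y)) x (F.e α x))
      = F.frameDeriv α (F.connCoeff D β μ ρ) x
        + ∑ σ, F.connCoeff D β μ σ x * F.connCoeff D α σ ρ x := fun α β ↦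
    coframe_covariantDerivative D hx (fun σ ↦ smoothFun_connCoeff τ D β μ σ)
      (fun y hy ↦ covariantDerivative_e D hy β μ) α ρ
  have h3 : F.coframe ρ x (D (F.e μ) x (mlieBracket (𝓡 4) (F.e α) (F.e β) x))
      = ∑ κ, F.structureFun α β κ x * F.connCoeff D κ μ ρ x := by
    rw [mlieBracket_e hx]
    simp [connCoeff]
  rw [curvature, curvatureOp, map_sub, map_sub, h, h, h3]
  ring

lemma frameDeriv_metric {g : LorentzMetric M} {D : Connection M} (hD : IsMetricCompatible g D)
    (hx : x ∈ F.dom) (α μ ν : Fin 4) :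
    F.frameDeriv α (F.metric g μ ν) x
      = ∑ σ, (F.connCoeff D α μ σ x * F.metric g σ ν x
        + F.connCoeff D α ν σ x * F.metric g μ σ x) := by
  have h := hD x (F.e α x) (F.e μ) (F.e ν) (F.mdifferentiableAt_e hx μ) (F.mdifferentiableAt_e hx ν)
  rw [covariantDerivative_e D hx, covariantDerivative_e D hx] at h
  simpa [frameDeriv, metric, Finset.sum_add_distrib] using! h

end Components

/-! ### Matrix-valued functions -/

section MatrixCalculus

/-- A matrix-valued function with smooth entries. -/
def SmoothMat (F : MovingFrame M) (A : M → Matrix (Fin 4) (Fin 4) ℝ) : Prop :=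
  ∀ i j, F.SmoothFun fun y ↦ A y i j

/-- The entrywise derivative of a matrix-valued function along a vector field of the frame. -/
noncomputable def matDeriv (F : MovingFrame M) (α : Fin 4) (A : M → Matrix (Fin 4) (Fin 4) ℝ)
    (x : M) : Matrix (Fin 4) (Fin 4) ℝ :=
  Matrix.of fun i j ↦ F.frameDeriv α (fun y ↦ A y i j) x

variable {A B : M → Matrix (Fin 4) (Fin 4) ℝ} {x : M}

lemma SmoothMat.add (hA : F.SmoothMat A) (hB : F.SmoothMat B) : F.SmoothMat fun y ↦ A y + B y :=
  fun i j ↦ (hA i j).add (hB i j)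

lemma SmoothMat.sub (hA : F.SmoothMat A) (hB : F.SmoothMat B) : F.SmoothMat fun y ↦ A y - B y :=
  fun i j ↦ (hA i j).sub (hB i j)

lemma SmoothMat.mul (hA : F.SmoothMat A) (hB : F.SmoothMat B) : F.SmoothMat fun y ↦ A y * B y :=
  fun i j ↦ by
    simpa only [Matrix.mul_apply] using SmoothFun.sum fun k ↦ (hA i k).mul (hB k j)

lemma SmoothMat.transpose (hA : F.SmoothMat A) : F.SmoothMat fun y ↦ (A y).transpose :=
  fun i j ↦ hA j i

lemma SmoothMat.sum_smul {f : Fin 4 → M → ℝ} {A : Fin 4 → M → Matrix (Fin 4) (Fin 4) ℝ}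
    (hf : ∀ i, F.SmoothFun (f i)) (hA : ∀ i, F.SmoothMat (A i)) :
    F.SmoothMat fun y ↦ ∑ κ, f κ y • A κ y :=
  fun i j ↦ by
    simpa only [Matrix.sum_apply, Matrix.smul_apply, smul_eq_mul] using
      SmoothFun.sum fun k ↦ (hf k).mul (hA k i j)

lemma SmoothMat.matDeriv {g : LorentzMetric M} (τ : VolumeForm g) (hA : F.SmoothMat A)
    (α : Fin 4) : F.SmoothMat (F.matDeriv α A) :=
  fun i j ↦ (hA i j).frameDeriv τ α

lemma matDeriv_congr (h : ∀ y ∈ F.dom, A y = B y) (hx : x ∈ F.dom) (α : Fin 4) :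
    F.matDeriv α A x = F.matDeriv α B x := by
  ext i j
  exact frameDeriv_congr (fun y hy ↦ by rw [h y hy]) hx α

lemma matDeriv_add (hA : F.SmoothMat A) (hB : F.SmoothMat B) (hx : x ∈ F.dom) (α : Fin 4) :
    F.matDeriv α (fun y ↦ A y + B y) x = F.matDeriv α A x + F.matDeriv α B x := by
  ext i j
  exact frameDeriv_add (hA i j) (hB i j) hx α

lemma matDeriv_sub (hA : F.SmoothMat A) (hB : F.SmoothMat B) (hx : x ∈ F.dom) (α : Fin 4) :
    F.matDeriv α (fun y ↦ A y - B y) x = F.matDeriv α A x - F.matDeriv α B x := by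
  ext i j
  exact frameDeriv_sub (hA i j) (hB i j) hx α

lemma matDeriv_mul (hA : F.SmoothMat A) (hB : F.SmoothMat B) (hx : x ∈ F.dom) (α : Fin 4) :
    F.matDeriv α (fun y ↦ A y * B y) x = F.matDeriv α A x * B x + A x * F.matDeriv α B x := by
  ext i j
  simp only [matDeriv, Matrix.of_apply, Matrix.mul_apply, Matrix.add_apply]
  rw [frameDeriv_sum (fun k ↦ (hA i k).mul (hB k j)) hx, ← Finset.sum_add_distrib]
  exact Finset.sum_congr rfl fun k _ ↦ frameDeriv_mul (hA i k) (hB k j) hx α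

lemma matDeriv_sum_smul {f : Fin 4 → M → ℝ} {A : Fin 4 → M → Matrix (Fin 4) (Fin 4) ℝ}
    (hf : ∀ i, F.SmoothFun (f i)) (hA : ∀ i, F.SmoothMat (A i)) (hx : x ∈ F.dom) (α : Fin 4) :
    F.matDeriv α (fun y ↦ ∑ κ, f κ y • A κ y) x
      = ∑ κ, F.frameDeriv α (f κ) x • A κ x + ∑ κ, f κ x • F.matDeriv α (A κ) x := by
  ext i j
  simp only [matDeriv, Matrix.of_apply, Matrix.sum_apply, Matrix.smul_apply, Matrix.add_apply,
    smul_eq_mul]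
  rw [frameDeriv_sum (fun k ↦ (hf k).mul (hA k i j)) hx, ← Finset.sum_add_distrib]
  exact Finset.sum_congr rfl fun k _ ↦ frameDeriv_mul (hf k) (hA k i j) hx α

lemma matDeriv_transpose (α : Fin 4) :
    F.matDeriv α (fun y ↦ (A y).transpose) x = (F.matDeriv α A x).transpose := rfl

lemma matDeriv_comm {g : LorentzMetric M} (τ : VolumeForm g) (hA : F.SmoothMat A)
    (hx : x ∈ F.dom) (α β : Fin 4) :
    F.matDeriv α (F.matDeriv β A) x - F.matDeriv β (F.matDeriv α A) x
      = ∑ κ, F.structureFun α β κ x • F.matDeriv κ A x := by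
  ext i j
  simp only [Matrix.sum_apply, Matrix.smul_apply, smul_eq_mul]
  exact frameDeriv_comm τ (hA i j) hx α β

end MatrixCalculus

/-! ### The curvature matrix and the second Bianchi identity in matrix form -/

section Curvature

/-- The matrix `A_α` of connection coefficients, `(A_α)^ρ_μ = L^ρ_{αμ}`. -/
noncomputable def connMatrix (F : MovingFrame M) (D : Connection M) (α : Fin 4) (x : M) :
    Matrix (Fin 4) (Fin 4) ℝ :=
  Matrix.of fun ρ μ ↦ F.connCoeff D α μ ρ x

/-- The matrix `Ω_{αβ}` of curvature components, `(Ω_{αβ})^ρ_μ = R_μ^ρ_{αβ}`. -/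
noncomputable def curvMatrix (F : MovingFrame M) (D : Connection M) (α β : Fin 4) (x : M) :
    Matrix (Fin 4) (Fin 4) ℝ :=
  Matrix.of fun ρ μ ↦ F.curvature D μ ρ α β x

variable {x : M}

lemma smoothMat_connMatrix [T2Space M] {g : LorentzMetric M} (τ : VolumeForm g)
    (D : Connection M) [CovariantDerivative.ContMDiffCovariantDerivative D ∞] (α : Fin 4) :
    F.SmoothMat (F.connMatrix D α) :=
  fun i j ↦ smoothFun_connCoeff τ D α j i

lemma smoothMat_gram (g : LorentzMetric M) : F.SmoothMat (F.gram g) :=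
  fun i j ↦ smoothFun_metric g i j

/-- The structure equation `Ω_{αβ} = ∂_α A_β - ∂_β A_α + [A_α, A_β] - c^κ_{αβ} A_κ`. -/
lemma curvMatrix_eq [T2Space M] {g : LorentzMetric M} (τ : VolumeForm g) (D : Connection M)
    [CovariantDerivative.ContMDiffCovariantDerivative D ∞] (hx : x ∈ F.dom) (α β : Fin 4) :
    F.curvMatrix D α β x
      = F.matDeriv α (F.connMatrix D β) x - F.matDeriv β (F.connMatrix D α) x
        + F.connMatrix D α x * F.connMatrix D β x - F.connMatrix D β x * F.connMatrix D α x
        - ∑ κ, F.structureFun α β κ x • F.connMatrix D κ x := by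
  ext ρ μ
  simp only [curvMatrix, matDeriv, connMatrix, Matrix.of_apply, Matrix.sub_apply,
    Matrix.add_apply, Matrix.mul_apply, Matrix.sum_apply, Matrix.smul_apply, smul_eq_mul]
  rw [curvature_eq τ D hx]
  simp only [mul_comm (F.connCoeff D β μ _ x), mul_comm (F.connCoeff D α μ _ x)]

lemma curvature_antisymm (D : Connection M) (μ ρ α β : Fin 4) (x : M) :
    F.curvature D μ ρ α β x = -F.curvature D μ ρ β α x := by
  rw [curvature, curvature, ← map_neg]
  congr 1
  simp only [curvatureOp]
  rw [mlieBracket_swap]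
  simp only [Pi.neg_apply, map_neg]
  abel

lemma curvMatrix_antisymm (D : Connection M) (α β : Fin 4) (x : M) :
    F.curvMatrix D α β x = -F.curvMatrix D β α x := by
  ext ρ μ
  exact curvature_antisymm D μ ρ α β x

lemma matDeriv_gram {g : LorentzMetric M} {D : Connection M} (hD : IsMetricCompatible g D)
    (hx : x ∈ F.dom) (α : Fin 4) :
    F.matDeriv α (F.gram g) x
      = (F.connMatrix D α x).transpose * F.gram g x + F.gram g x * F.connMatrix D α x := by
  ext μ ν
  simp only [matDeriv, connMatrix, gram, Matrix.of_apply, Matrix.add_apply, Matrix.mul_apply,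
    Matrix.transpose_apply]
  rw [frameDeriv_metric hD hx, ← Finset.sum_add_distrib]
  exact Finset.sum_congr rfl fun σ _ ↦ by ring

/-- The curvature of a metric connection is skew for `g`: differentiate
`∂_α g = A_αᵀ g + g A_α` once more and antisymmetrise. -/
lemma curvMatrix_skew [T2Space M] {g : LorentzMetric M} (τ : VolumeForm g) {D : Connection M}
    [CovariantDerivative.ContMDiffCovariantDerivative D ∞] (hD : IsMetricCompatible g D)
    (hx : x ∈ F.dom) (α β : Fin 4) :
    (F.curvMatrix D α β x).transpose * F.gram g x + F.gram g x * F.curvMatrix D α β x = 0 := by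
  have hG : F.SmoothMat (F.gram g) := smoothMat_gram g
  have hA : ∀ α, F.SmoothMat (F.connMatrix D α) := smoothMat_connMatrix τ D
  -- The second derivatives of the Gram matrix; their commutator is `c^κ_{αβ} ∂_κ g`.
  have h2 : ∀ α β, F.matDeriv α (F.matDeriv β (F.gram g)) x
      = (F.matDeriv α (F.connMatrix D β) x).transpose * F.gram g x
        + (F.connMatrix D β x).transpose * ((F.connMatrix D α x).transpose * F.gram g x
          + F.gram g x * F.connMatrix D α x)
        + (((F.connMatrix D α x).transpose * F.gram g x + F.gram g x * F.connMatrix D α x)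
          * F.connMatrix D β x + F.gram g x * F.matDeriv α (F.connMatrix D β) x) := by
    intro α β
    rw [matDeriv_congr (fun y hy ↦ matDeriv_gram hD hy β) hx,
      matDeriv_add ((hA β).transpose.mul hG) (hG.mul (hA β)) hx,
      matDeriv_mul (hA β).transpose hG hx, matDeriv_mul hG (hA β) hx, matDeriv_gram hD hx,
      matDeriv_transpose]
  have h := matDeriv_comm τ hG hx α β
  rw [h2, h2] at h
  simp only [matDeriv_gram hD hx, smul_add, Finset.sum_add_distrib] at h
  have h3 : ∑ κ, F.structureFun α β κ x • ((F.connMatrix D κ x).transpose * F.gram g x)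
      = (∑ κ, F.structureFun α β κ x • F.connMatrix D κ x).transpose * F.gram g x := by
    simp [Matrix.transpose_sum, Finset.sum_mul]
  have h4 : ∑ κ, F.structureFun α β κ x • (F.gram g x * F.connMatrix D κ x)
      = F.gram g x * ∑ κ, F.structureFun α β κ x • F.connMatrix D κ x := by
    simp [Finset.mul_sum]
  rw [h3, h4] at h
  rw [curvMatrix_eq τ D hx]
  simp only [Matrix.transpose_sub, Matrix.transpose_add, Matrix.transpose_mul]
  rw [← sub_eq_zero] at h
  rw [← h]
  noncomm_ring

/-- The second Bianchi identity in matrix form, without assumption on the torsion: the cyclic sum of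
`∂_μ Ω_{νρ} + [A_μ, Ω_{νρ}] - c^κ_{μν} Ω_{κρ}` vanishes. Insert the structure equation; second
derivatives of `A` combine by `matDeriv_comm`, triple products cancel. -/
lemma sum_matDeriv_curvMatrix [T2Space M] {g : LorentzMetric M} (τ : VolumeForm g)
    (D : Connection M) [CovariantDerivative.ContMDiffCovariantDerivative D ∞]
    (hx : x ∈ F.dom) (μ ν ρ : Fin 4) :
    (F.matDeriv μ (F.curvMatrix D ν ρ) x + F.connMatrix D μ x * F.curvMatrix D ν ρ x
        - F.curvMatrix D ν ρ x * F.connMatrix D μ x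
        - ∑ κ, F.structureFun μ ν κ x • F.curvMatrix D κ ρ x)
      + (F.matDeriv ν (F.curvMatrix D ρ μ) x + F.connMatrix D ν x * F.curvMatrix D ρ μ x
        - F.curvMatrix D ρ μ x * F.connMatrix D ν x
        - ∑ κ, F.structureFun ν ρ κ x • F.curvMatrix D κ μ x)
      + (F.matDeriv ρ (F.curvMatrix D μ ν) x + F.connMatrix D ρ x * F.curvMatrix D μ ν x
        - F.curvMatrix D μ ν x * F.connMatrix D ρ x
        - ∑ κ, F.structureFun ρ μ κ x • F.curvMatrix D κ ν x) = 0 := by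
  have hA : ∀ α, F.SmoothMat (F.connMatrix D α) := smoothMat_connMatrix τ D
  have hc : ∀ α β κ, F.SmoothFun (F.structureFun α β κ) := smoothFun_structureFun τ
  have h1 : ∀ μ α β, F.matDeriv μ (F.curvMatrix D α β) x
      = F.matDeriv μ (F.matDeriv α (F.connMatrix D β)) x
        - F.matDeriv μ (F.matDeriv β (F.connMatrix D α)) x
        + (F.matDeriv μ (F.connMatrix D α) x * F.connMatrix D β x
          + F.connMatrix D α x * F.matDeriv μ (F.connMatrix D β) x)
        - (F.matDeriv μ (F.connMatrix D β) x * F.connMatrix D α x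
          + F.connMatrix D β x * F.matDeriv μ (F.connMatrix D α) x)
        - (∑ κ, F.frameDeriv μ (F.structureFun α β κ) x • F.connMatrix D κ x
          + ∑ κ, F.structureFun α β κ x • F.matDeriv μ (F.connMatrix D κ) x) := by
    intro μ α β
    have e1 := ((hA β).matDeriv τ α).sub ((hA α).matDeriv τ β)
    have e2 := e1.add ((hA α).mul (hA β))
    have e3 := e2.sub ((hA β).mul (hA α))
    rw [matDeriv_congr (fun y hy ↦ curvMatrix_eq τ D hy α β) hx,
      matDeriv_sub e3 (SmoothMat.sum_smul (hc α β) hA) hx,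
      matDeriv_sub e2 ((hA β).mul (hA α)) hx, matDeriv_add e1 ((hA α).mul (hA β)) hx,
      matDeriv_sub ((hA β).matDeriv τ α) ((hA α).matDeriv τ β) hx,
      matDeriv_mul (hA α) (hA β) hx, matDeriv_mul (hA β) (hA α) hx,
      matDeriv_sum_smul (hc α β) hA hx]
  have h2 : ∀ α β γ, ∑ κ, F.structureFun α β κ x • F.curvMatrix D κ γ x
      = (F.matDeriv α (F.matDeriv β (F.connMatrix D γ)) x
          - F.matDeriv β (F.matDeriv α (F.connMatrix D γ)) x)
        - ∑ κ, F.structureFun α β κ x • F.matDeriv γ (F.connMatrix D κ) x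
        + (∑ κ, F.structureFun α β κ x • F.connMatrix D κ x) * F.connMatrix D γ x
        - F.connMatrix D γ x * (∑ κ, F.structureFun α β κ x • F.connMatrix D κ x)
        - ∑ κ, F.structureFun α β κ x • ∑ σ, F.structureFun κ γ σ x • F.connMatrix D σ x := by
    intro α β γ
    rw [matDeriv_comm τ (hA γ) hx]
    simp only [curvMatrix_eq τ D hx, smul_sub, smul_add, Finset.sum_sub_distrib,
      Finset.sum_add_distrib, Finset.sum_mul, Finset.mul_sum, Matrix.smul_mul, Matrix.mul_smul]
  -- The Jacobi identity disposes of the derivatives of the structure functions.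
  have h3 : (∑ κ, F.frameDeriv μ (F.structureFun ν ρ κ) x • F.connMatrix D κ x)
      + (∑ κ, F.frameDeriv ν (F.structureFun ρ μ κ) x • F.connMatrix D κ x)
      + (∑ κ, F.frameDeriv ρ (F.structureFun μ ν κ) x • F.connMatrix D κ x)
      = (∑ κ, F.structureFun μ ν κ x • ∑ σ, F.structureFun κ ρ σ x • F.connMatrix D σ x)
        + (∑ κ, F.structureFun ν ρ κ x • ∑ σ, F.structureFun κ μ σ x • F.connMatrix D σ x)
        + ∑ κ, F.structureFun ρ μ κ x • ∑ σ, F.structureFun κ ν σ x • F.connMatrix D σ x := by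
    have e : ∀ α β γ, ∑ κ, F.structureFun α β κ x • ∑ σ, F.structureFun κ γ σ x • F.connMatrix D σ x
        = ∑ σ, (-∑ κ, F.structureFun α β κ x * F.structureFun γ κ σ x) • F.connMatrix D σ x := by
      intro α β γ
      simp only [Finset.smul_sum]
      rw [Finset.sum_comm]
      refine Finset.sum_congr rfl fun σ _ ↦ ?_
      rw [neg_smul, Finset.sum_smul, ← Finset.sum_neg_distrib]
      refine Finset.sum_congr rfl fun κ _ ↦ ?_
      rw [structureFun_antisymm κ γ, smul_smul, mul_neg, neg_smul]
    rw [e, e, e]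
    simp only [← Finset.sum_add_distrib, ← add_smul]
    refine Finset.sum_congr rfl fun σ _ ↦ ?_
    congr 1
    linarith [jacobi_structureFun τ hx μ ν ρ σ]
  rw [h1, h1, h1, h2, h2, h2, curvMatrix_eq τ D hx, curvMatrix_eq τ D hx, curvMatrix_eq τ D hx]
  rw [← sub_eq_zero, ← neg_eq_zero] at h3
  rw [← h3]
  noncomm_ring

end Curvature

variable {x : M}

/-! ### The first Bianchi identity with torsion -/

section FirstBianchi

lemma smoothFun_torsion [T2Space M] {g : LorentzMetric M} (τ : VolumeForm g)
    (D : Connection M) [CovariantDerivative.ContMDiffCovariantDerivative D ∞] (ρ α β : Fin 4) :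
    F.SmoothFun (F.torsion D ρ α β) :=
  (((smoothFun_connCoeff τ D α β ρ).sub (smoothFun_connCoeff τ D β α ρ)).sub
    (smoothFun_structureFun τ α β ρ)).congr fun _ hy ↦ torsion_eq D hy ρ α β

lemma frameDeriv_torsion [T2Space M] {g : LorentzMetric M} (τ : VolumeForm g)
    (D : Connection M) [CovariantDerivative.ContMDiffCovariantDerivative D ∞] (hx : x ∈ F.dom)
    (μ ρ α β : Fin 4) :
    F.frameDeriv μ (F.torsion D ρ α β) x
      = F.frameDeriv μ (F.connCoeff D α β ρ) x - F.frameDeriv μ (F.connCoeff D β α ρ) x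
        - F.frameDeriv μ (F.structureFun α β ρ) x := by
  rw [frameDeriv_congr (fun y hy ↦ torsion_eq D hy ρ α β) hx,
    frameDeriv_sub ((smoothFun_connCoeff τ D α β ρ).sub (smoothFun_connCoeff τ D β α ρ))
      (smoothFun_structureFun τ α β ρ) hx,
    frameDeriv_sub (smoothFun_connCoeff τ D α β ρ) (smoothFun_connCoeff τ D β α ρ) hx]

/-- The summand `D_μ T^ρ_{αβ} - T^κ_{μβ} T^ρ_{κα}` of the first Bianchi identity, with the upper
index not lowered. -/
noncomputable def bianchiTerm (F : MovingFrame M) (D : Connection M) (ρ μ α β : Fin 4) (x : M) :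
    ℝ :=
  F.frameDeriv μ (F.torsion D ρ α β) x + ∑ κ, (F.connCoeff D μ κ ρ x * F.torsion D κ α β x
    - F.connCoeff D μ α κ x * F.torsion D ρ κ β x - F.connCoeff D μ β κ x * F.torsion D ρ α κ x)
    - ∑ κ, F.torsion D κ μ β x * F.torsion D ρ κ α x

/-- The first Bianchi identity for a connection with torsion, in a frame. Written out in connection
coefficients and structure functions it reduces to the Jacobi identity. -/
lemma sum_bianchiTerm [T2Space M] {g : LorentzMetric M} (τ : VolumeForm g)
    (D : Connection M) [CovariantDerivative.ContMDiffCovariantDerivative D ∞] (hx : x ∈ F.dom)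
    (ρ μ α β : Fin 4) :
    F.bianchiTerm D ρ μ α β x + F.bianchiTerm D ρ α β μ x + F.bianchiTerm D ρ β μ α x
      = F.curvature D μ ρ α β x + F.curvature D α ρ β μ x + F.curvature D β ρ μ α x := by
  have hJ := jacobi_structureFun τ hx μ α β ρ
  have h1 : ∀ κ, F.structureFun β α κ x = -F.structureFun α β κ x :=
    fun κ ↦ structureFun_antisymm _ _ _ _
  have h2 : ∀ κ, F.structureFun μ β κ x = -F.structureFun β μ κ x :=
    fun κ ↦ structureFun_antisymm _ _ _ _
  have h3 : ∀ κ, F.structureFun α μ κ x = -F.structureFun μ α κ x :=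
    fun κ ↦ structureFun_antisymm _ _ _ _
  have h4 : ∀ κ, F.structureFun κ α ρ x = -F.structureFun α κ ρ x :=
    fun κ ↦ structureFun_antisymm _ _ _ _
  have h5 : ∀ κ, F.structureFun κ β ρ x = -F.structureFun β κ ρ x :=
    fun κ ↦ structureFun_antisymm _ _ _ _
  have h6 : ∀ κ, F.structureFun κ μ ρ x = -F.structureFun μ κ ρ x :=
    fun κ ↦ structureFun_antisymm _ _ _ _
  simp only [bianchiTerm, curvature_eq τ D hx, frameDeriv_torsion τ D hx, torsion_eq D hx,
    h1, h2, h3, h4, h5, h6]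
  simp only [Fin.sum_univ_four] at hJ ⊢
  linear_combination -hJ

/-- Lowering an index commutes with the covariant derivative of a metric connection. -/
lemma covDeriv₃_lower₃ {g : LorentzMetric M} {D : Connection M}
    (hD : IsMetricCompatible g D) {T : Fin 4 → Fin 4 → Fin 4 → M → ℝ}
    (hT : ∀ ρ α β, F.SmoothFun (T ρ α β)) (hx : x ∈ F.dom) (μ ρ α β : Fin 4) :
    F.covDeriv₃ D (F.lower₃ g T) μ ρ α β x
      = ∑ σ, F.metric g ρ σ x * (F.frameDeriv μ (T σ α β) x
        + ∑ κ, (F.connCoeff D μ κ σ x * T κ α β x - F.connCoeff D μ α κ x * T σ κ β x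
          - F.connCoeff D μ β κ x * T σ α κ x)) := by
  have h1 : mvfderiv (𝓡 4) (F.lower₃ g T ρ α β) x (F.e μ x)
      = ∑ σ, ((∑ κ, (F.connCoeff D μ ρ κ x * F.metric g κ σ x
          + F.connCoeff D μ σ κ x * F.metric g ρ κ x)) * T σ α β x
        + F.metric g ρ σ x * F.frameDeriv μ (T σ α β) x) := by
    have := frameDeriv_sum (F := F) (f := fun σ y ↦ F.metric g ρ σ y * T σ α β y)
      (fun σ ↦ (smoothFun_metric g ρ σ).mul (hT σ α β)) hx μ
    refine this.trans (Finset.sum_congr rfl fun σ _ ↦ ?_)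
    rw [frameDeriv_mul (smoothFun_metric g ρ σ) (hT σ α β) hx, frameDeriv_metric hD hx]
  rw [covDeriv₃, h1]
  simp only [lower₃, Fin.sum_univ_four]
  ring

/-- The right-hand side of the first Bianchi identity of a metric connection is the cyclic sum of
its curvature. -/
lemma bianchiSum_torsion [T2Space M] {g : LorentzMetric M} (τ : VolumeForm g) {D : Connection M}
    [CovariantDerivative.ContMDiffCovariantDerivative D ∞] (hD : IsMetricCompatible g D)
    (hx : x ∈ F.dom) (ρ μ α β : Fin 4) :
    F.bianchiSum g D (F.torsion D) ρ μ α β x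
      = F.lower₄ g (F.curvature D) μ ρ α β x + F.lower₄ g (F.curvature D) α ρ β μ x
        + F.lower₄ g (F.curvature D) β ρ μ α x := by
  have h : ∀ μ α β, F.covDeriv₃ D (F.lower₃ g (F.torsion D)) μ ρ α β x
      - ∑ κ, F.torsion D κ μ β x * F.lower₃ g (F.torsion D) ρ κ α x
      = ∑ σ, F.metric g ρ σ x * F.bianchiTerm D σ μ α β x := by
    intro μ α β
    have h1 : ∑ κ, F.torsion D κ μ β x * F.lower₃ g (F.torsion D) ρ κ α x
        = ∑ σ, F.metric g ρ σ x * ∑ κ, F.torsion D κ μ β x * F.torsion D σ κ α x := by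
      simp only [lower₃, Finset.mul_sum]
      rw [Finset.sum_comm]
      exact Finset.sum_congr rfl fun _ _ ↦ Finset.sum_congr rfl fun _ _ ↦ by ring
    rw [covDeriv₃_lower₃ hD (smoothFun_torsion τ D) hx, h1, ← Finset.sum_sub_distrib]
    exact Finset.sum_congr rfl fun σ _ ↦ by rw [bianchiTerm]; ring
  simp only [bianchiSum, h, lower₄, ← Finset.sum_add_distrib, ← mul_add]
  exact Finset.sum_congr rfl fun σ _ ↦ by rw [sum_bianchiTerm τ D hx]

lemma covDeriv₃_congr {D : Connection M} {S S' : Fin 4 → Fin 4 → Fin 4 → M → ℝ}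
    (h : ∀ y ∈ F.dom, ∀ ρ α β, S ρ α β y = S' ρ α β y) (hx : x ∈ F.dom) (μ ρ α β : Fin 4) :
    F.covDeriv₃ D S μ ρ α β x = F.covDeriv₃ D S' μ ρ α β x := by
  have h1 := frameDeriv_congr (F := F) (fun y hy ↦ h y hy ρ α β) hx μ
  simp only [frameDeriv] at h1
  simp only [covDeriv₃, h1, h x hx]

lemma bianchiSum_congr {g : LorentzMetric M} {D : Connection M}
    {T T' : Fin 4 → Fin 4 → Fin 4 → M → ℝ}
    (h : ∀ y ∈ F.dom, ∀ ρ α β, T ρ α β y = T' ρ α β y) (hx : x ∈ F.dom) (ρ μ α β : Fin 4) :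
    F.bianchiSum g D T ρ μ α β x = F.bianchiSum g D T' ρ μ α β x := by
  have hl : ∀ y ∈ F.dom, ∀ ρ α β, F.lower₃ g T ρ α β y = F.lower₃ g T' ρ α β y :=
    fun y hy ρ α β ↦ by simp only [lower₃, h y hy]
  simp only [bianchiSum, covDeriv₃_congr hl hx, h x hx, hl x hx]

end FirstBianchi

/-! ### The second Bianchi identity without torsion -/

section SecondBianchi

lemma smoothMat_curvMatrix [T2Space M] {g : LorentzMetric M} (τ : VolumeForm g)
    (D : Connection M) [CovariantDerivative.ContMDiffCovariantDerivative D ∞] (α β : Fin 4) :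
    F.SmoothMat (F.curvMatrix D α β) := by
  have hA : ∀ α, F.SmoothMat (F.connMatrix D α) := smoothMat_connMatrix τ D
  have h := (((((hA β).matDeriv τ α).sub ((hA α).matDeriv τ β)).add ((hA α).mul (hA β))).sub
    ((hA β).mul (hA α))).sub (SmoothMat.sum_smul (smoothFun_structureFun τ α β) hA)
  exact fun i j ↦ (h i j).congr fun y hy ↦ by rw [curvMatrix_eq τ D hy]

lemma lower₄_curvature (g : LorentzMetric M) (D : Connection M) (β α ν ρ : Fin 4) (y : M) :
    F.lower₄ g (F.curvature D) β α ν ρ y = (F.gram g y * F.curvMatrix D ν ρ y) α β := by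
  simp [lower₄, gram, curvMatrix, Matrix.mul_apply]

lemma covDeriv₄_lower₄_curvature [T2Space M] {g : LorentzMetric M} (τ : VolumeForm g)
    {D : Connection M} [CovariantDerivative.ContMDiffCovariantDerivative D ∞]
    (hD : IsMetricCompatible g D) (hx : x ∈ F.dom) (μ β α ν ρ : Fin 4) :
    F.covDeriv₄ D (F.lower₄ g (F.curvature D)) μ β α ν ρ x
      = (F.gram g x * (F.matDeriv μ (F.curvMatrix D ν ρ) x
        + F.connMatrix D μ x * F.curvMatrix D ν ρ x - F.curvMatrix D ν ρ x * F.connMatrix D μ x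
        - ∑ κ, F.connCoeff D μ ν κ x • F.curvMatrix D κ ρ x
        - ∑ κ, F.connCoeff D μ ρ κ x • F.curvMatrix D ν κ x)) α β := by
  have h1 : mvfderiv (𝓡 4) (F.lower₄ g (F.curvature D) β α ν ρ) x (F.e μ x)
      = (((F.connMatrix D μ x).transpose * F.gram g x + F.gram g x * F.connMatrix D μ x)
        * F.curvMatrix D ν ρ x + F.gram g x * F.matDeriv μ (F.curvMatrix D ν ρ) x) α β := by
    rw [← matDeriv_gram hD hx, ← matDeriv_mul (smoothMat_gram g) (smoothMat_curvMatrix τ D ν ρ) hx]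
    exact frameDeriv_congr (fun y _ ↦ lower₄_curvature g D β α ν ρ y) hx μ
  have h2 : ∑ σ, F.connCoeff D μ β σ x * F.lower₄ g (F.curvature D) σ α ν ρ x
      = (F.gram g x * F.curvMatrix D ν ρ x * F.connMatrix D μ x) α β := by
    rw [Matrix.mul_apply]
    exact Finset.sum_congr rfl fun σ _ ↦ by rw [lower₄_curvature, mul_comm]; rfl
  have h3 : ∑ σ, F.connCoeff D μ α σ x * F.lower₄ g (F.curvature D) β σ ν ρ x
      = ((F.connMatrix D μ x).transpose * (F.gram g x * F.curvMatrix D ν ρ x)) α β := by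
    rw [Matrix.mul_apply]
    exact Finset.sum_congr rfl fun σ _ ↦ by rw [lower₄_curvature]; rfl
  have h4 : ∑ σ, F.connCoeff D μ ν σ x * F.lower₄ g (F.curvature D) β α σ ρ x
      = (F.gram g x * ∑ κ, F.connCoeff D μ ν κ x • F.curvMatrix D κ ρ x) α β := by
    simp [lower₄_curvature, Finset.mul_sum, Matrix.sum_apply]
  have h5 : ∑ σ, F.connCoeff D μ ρ σ x * F.lower₄ g (F.curvature D) β α ν σ x
      = (F.gram g x * ∑ κ, F.connCoeff D μ ρ κ x • F.curvMatrix D ν κ x) α β := by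
    simp [lower₄_curvature, Finset.mul_sum, Matrix.sum_apply]
  rw [covDeriv₄, h1]
  simp only [Finset.sum_add_distrib]
  rw [h2, h3, h4, h5]
  simp only [← Matrix.add_apply, ← Matrix.sub_apply]
  refine congrFun (congrFun ?_ α) β
  noncomm_ring

/-- The second Bianchi identity for a torsion-free metric connection. -/
lemma sum_covDeriv₄_curvature [T2Space M] {g : LorentzMetric M} (τ : VolumeForm g)
    {D : Connection M} [CovariantDerivative.ContMDiffCovariantDerivative D ∞]
    (hD : IsMetricCompatible g D) (hT : D.torsion = 0) (hx : x ∈ F.dom) (μ ν ρ α β : Fin 4) :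
    F.covDeriv₄ D (F.lower₄ g (F.curvature D)) μ β α ν ρ x
      + F.covDeriv₄ D (F.lower₄ g (F.curvature D)) ν β α ρ μ x
      + F.covDeriv₄ D (F.lower₄ g (F.curvature D)) ρ β α μ ν x = 0 := by
  have hc : ∀ α β κ, F.structureFun α β κ x = F.connCoeff D α β κ x - F.connCoeff D β α κ x := by
    intro α β κ
    have := torsion_eq D hx κ α β
    simp only [torsion, hT, Pi.zero_apply, _root_.zero_apply, map_zero] at this
    linarith
  have hB := sum_matDeriv_curvMatrix τ D hx μ ν ρ
  have hs : ∀ α β γ, ∑ κ, F.structureFun α β κ x • F.curvMatrix D κ γ x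
      = ∑ κ, F.connCoeff D α β κ x • F.curvMatrix D κ γ x
        + ∑ κ, F.connCoeff D β α κ x • F.curvMatrix D γ κ x := by
    intro α β γ
    rw [← Finset.sum_add_distrib]
    refine Finset.sum_congr rfl fun κ _ ↦ ?_
    rw [hc, curvMatrix_antisymm D γ κ]
    module
  rw [hs, hs, hs] at hB
  simp only [covDeriv₄_lower₄_curvature τ hD hx, ← Matrix.add_apply, ← mul_add]
  have h0 : ∀ X : Matrix (Fin 4) (Fin 4) ℝ, X = 0 → (F.gram g x * X) α β = 0 := by
    rintro X rfl
    simp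
  refine h0 _ (Eq.trans ?_ hB)
  abel

lemma covDeriv₄_congr {D : Connection M} {S S' : Fin 4 → Fin 4 → Fin 4 → Fin 4 → M → ℝ}
    (h : ∀ y ∈ F.dom, ∀ β α ν ρ, S β α ν ρ y = S' β α ν ρ y) (hx : x ∈ F.dom)
    (μ β α ν ρ : Fin 4) :
    F.covDeriv₄ D S μ β α ν ρ x = F.covDeriv₄ D S' μ β α ν ρ x := by
  have h1 := frameDeriv_congr (F := F) (fun y hy ↦ h y hy β α ν ρ) hx μ
  simp only [frameDeriv] at h1
  simp only [covDeriv₄, h1, h x hx]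

end SecondBianchi

end MovingFrame

/-! ### Algebra of the Levi-Civita symbol and of the Hodge dual -/

section LeviCivita

/-- The Levi-Civita symbol on four indices, as the sign of the Vandermonde product of the
indices. -/
def leviCivita (i j k l : Fin 4) : ℤ :=
  Int.sign (((j : ℤ) - i) * ((k : ℤ) - i) * ((l : ℤ) - i) * ((k : ℤ) - j) * ((l : ℤ) - j)
    * ((l : ℤ) - k))

/-- On permutations the Levi-Civita symbol is the signature. -/
lemma sign_eq_leviCivita : ∀ σ : Equiv.Perm (Fin 4),
    ((Equiv.Perm.sign σ : ℤˣ) : ℤ) = leviCivita (σ 0) (σ 1) (σ 2) (σ 3) := by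
  decide +kernel

lemma leviCivita_eq_zero {s : Fin 4 → Fin 4} {i j : Fin 4} (h : s i = s j) (hij : i ≠ j) :
    leviCivita (s 0) (s 1) (s 2) (s 3) = 0 := by
  have h' : ((s i : ℕ) : ℤ) = s j := by rw [h]
  rw [leviCivita, Int.sign_eq_zero_iff_zero]
  fin_cases i <;> fin_cases j <;> first | exact absurd rfl hij | simp_all

/-- An alternating 4-form on vectors chosen from `v 0, …, v 3` is its value on `v` times the
Levi-Civita symbol. -/
lemma alternatingMap_comp {V : Type*} [AddCommGroup V] [Module ℝ V] (f : V [⋀^Fin 4]→ₗ[ℝ] ℝ)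
    (v : Fin 4 → V) (s : Fin 4 → Fin 4) :
    f (fun i ↦ v (s i)) = leviCivita (s 0) (s 1) (s 2) (s 3) * f v := by
  by_cases hs : Function.Injective s
  · have h := f.map_perm v (Equiv.ofBijective s ⟨hs, Finite.surjective_of_injective hs⟩)
    have h2 : ((Equiv.Perm.sign (Equiv.ofBijective s ⟨hs, Finite.surjective_of_injective hs⟩)
        : ℤˣ) : ℤ) = leviCivita (s 0) (s 1) (s 2) (s 3) := sign_eq_leviCivita _
    rw [← h2]
    refine Eq.trans h ?_
    simp [Units.smul_def]
  · simp only [Function.Injective, not_forall] at hs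
    obtain ⟨i, j, h, hij⟩ := hs
    rw [f.map_eq_zero_of_eq (fun i ↦ v (s i)) (congrArg v h) hij, leviCivita_eq_zero h hij]
    simp

/-- Antisymmetrising over five indices in dimension four gives zero. -/
lemma schouten_leviCivita : ∀ τ κ ι μ α β : Fin 4,
    (if τ = μ then leviCivita κ ι α β else 0) + (if τ = α then leviCivita κ ι β μ else 0)
      + (if τ = β then leviCivita κ ι μ α else 0)
      + (if τ = ι then leviCivita μ α β κ else 0) - (if τ = κ then leviCivita μ α β ι else 0)
      = 0 := by
  decide +kernel

lemma leviCivita_contract : ∀ a b l m : Fin 4,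
    ∑ κ, ∑ ι, leviCivita a b κ ι * leviCivita κ ι l m
      = 2 * ((if a = l ∧ b = m then 1 else 0) - (if a = m ∧ b = l then 1 else 0)) := by
  decide +kernel

lemma leviCivita_rotate : ∀ i j k l : Fin 4, leviCivita i j k l = -leviCivita l i j k := by
  decide +kernel

lemma det_eq_sum_leviCivita (V : Matrix (Fin 4) (Fin 4) ℝ) :
    V.det = ∑ a, ∑ b, ∑ c, ∑ d, V 0 a * V 1 b * V 2 c * V 3 d * leviCivita a b c d := by
  rw [Matrix.det_succ_row_zero]
  simp only [Matrix.det_fin_three, Fin.sum_univ_four]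
  have h1 : Int.sign 12 = 1 := rfl
  have h2 : Int.sign (-12) = -1 := rfl
  simp [leviCivita, Fin.succAbove, h1, h2]
  ring

lemma sum_mul_leviCivita (N : Matrix (Fin 4) (Fin 4) ℝ) (i j k l : Fin 4) :
    ∑ a, ∑ b, ∑ c, ∑ d, N i a * N j b * N k c * N l d * leviCivita a b c d
      = N.det * leviCivita i j k l := by
  have h := alternatingMap_comp (Matrix.detRowAlternating (R := ℝ) (n := Fin 4)) N ![i, j, k, l]
  have h2 := det_eq_sum_leviCivita fun m ↦ N (![i, j, k, l] m)
  rw [mul_comm]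
  exact h2.symm.trans h

/-- The Hodge dual of a 2-form with components `B`, with `N` the inverse metric and
`e = τ(e_0, e_1, e_2, e_3)`. -/
noncomputable def hodgeMatrix (N : Matrix (Fin 4) (Fin 4) ℝ) (e : ℝ)
    (B : Matrix (Fin 4) (Fin 4) ℝ) : Matrix (Fin 4) (Fin 4) ℝ :=
  Matrix.of fun l s ↦ (1 / 2) * ∑ κ, ∑ ι, (N.transpose * B * N) κ ι * (e * leviCivita κ ι l s)

lemma transpose_mul_mul_apply (N B : Matrix (Fin 4) (Fin 4) ℝ) (κ ι : Fin 4) :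
    (N.transpose * B * N) κ ι = ∑ α, ∑ β, N α κ * B α β * N β ι := by
  simp only [Matrix.mul_apply, Matrix.transpose_apply, Finset.sum_mul]
  exact Finset.sum_comm

/-- Raising the indices of the Hodge dual of `B` gives `½ e det(N) B_{ab} [a b κ ι]`. -/
lemma raise_hodgeMatrix {N : Matrix (Fin 4) (Fin 4) ℝ} (hN : N.transpose = N) (e : ℝ)
    (B : Matrix (Fin 4) (Fin 4) ℝ) (κ ι : Fin 4) :
    (N.transpose * hodgeMatrix N e B * N) κ ι
      = (1 / 2) * (e * N.det) * ∑ a, ∑ b, B a b * leviCivita a b κ ι := by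
  have hs : ∀ i j, N i j = N j i := fun i j ↦ congrFun (congrFun hN j) i
  have h1 : (N.transpose * hodgeMatrix N e B * N) κ ι
      = ∑ p : Fin 4 × Fin 4, ∑ q : Fin 4 × Fin 4, ∑ r : Fin 4 × Fin 4,
        (1 / 2) * e * B r.1 r.2 * (N r.1 q.1 * N r.2 q.2 * N κ p.1 * N ι p.2
          * leviCivita q.1 q.2 p.1 p.2) := by
    simp only [Fintype.sum_prod_type, transpose_mul_mul_apply, hodgeMatrix, Matrix.of_apply,
      Finset.mul_sum, Finset.sum_mul]
    refine Finset.sum_congr rfl fun α _ ↦ Finset.sum_congr rfl fun β _ ↦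
      Finset.sum_congr rfl fun c _ ↦ Finset.sum_congr rfl fun d _ ↦
      Finset.sum_congr rfl fun a _ ↦ Finset.sum_congr rfl fun b _ ↦ ?_
    rw [hs κ α, hs ι β]
    ring
  -- The inner sums raise all four indices of the symbol, which yields `det N`.
  have h2 : ∀ a b, ∑ q : Fin 4 × Fin 4, ∑ p : Fin 4 × Fin 4,
      N a q.1 * N b q.2 * N κ p.1 * N ι p.2 * leviCivita q.1 q.2 p.1 p.2
      = N.det * leviCivita a b κ ι := by
    intro a b
    simp only [Fintype.sum_prod_type]
    exact sum_mul_leviCivita N a b κ ι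
  have h3 : ∀ f : Fin 4 × Fin 4 → Fin 4 × Fin 4 → Fin 4 × Fin 4 → ℝ,
      ∑ p, ∑ q, ∑ r, f p q r = ∑ r, ∑ q, ∑ p, f p q r := fun f ↦ by
    rw [Finset.sum_comm, Finset.sum_congr rfl fun q _ ↦ Finset.sum_comm, Finset.sum_comm]
  rw [h1, h3]
  simp only [← Finset.mul_sum, h2]
  simp only [Fintype.sum_prod_type, Finset.mul_sum]
  exact Finset.sum_congr rfl fun a _ ↦ Finset.sum_congr rfl fun b _ ↦ by ring

/-- In Lorentzian signature `⋆⋆ = -1` on 2-forms. -/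
lemma hodgeMatrix_hodgeMatrix {N : Matrix (Fin 4) (Fin 4) ℝ} (hN : N.transpose = N) {e : ℝ}
    (he : e ^ 2 * N.det = -1) {B : Matrix (Fin 4) (Fin 4) ℝ} (hB : ∀ a b, B a b = -B b a) :
    hodgeMatrix N e (hodgeMatrix N e B) = -B := by
  ext l m
  have h1 : hodgeMatrix N e (hodgeMatrix N e B) l m
      = ∑ p : Fin 4 × Fin 4, ∑ r : Fin 4 × Fin 4, (1 / 4) * (e ^ 2 * N.det)
        * (B r.1 r.2 * (leviCivita r.1 r.2 p.1 p.2 * leviCivita p.1 p.2 l m)) := by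
    conv_lhs => rw [hodgeMatrix]
    simp only [raise_hodgeMatrix hN, Matrix.of_apply, Fintype.sum_prod_type, Finset.mul_sum,
      Finset.sum_mul]
    refine Finset.sum_congr rfl fun α _ ↦ Finset.sum_congr rfl fun β _ ↦
      Finset.sum_congr rfl fun c _ ↦ Finset.sum_congr rfl fun d _ ↦ by ring
  have h2 : ∀ a b, ∑ p : Fin 4 × Fin 4,
      ((leviCivita a b p.1 p.2 : ℝ) * leviCivita p.1 p.2 l m)
      = 2 * ((if a = l ∧ b = m then 1 else 0) - (if a = m ∧ b = l then 1 else 0)) := by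
    intro a b
    rw [Fintype.sum_prod_type]
    exact_mod_cast leviCivita_contract a b l m
  rw [h1, Finset.sum_comm]
  simp only [← Finset.mul_sum, h2, he]
  simp only [Fintype.sum_prod_type, mul_sub, Finset.sum_sub_distrib, ite_and, mul_ite, mul_one,
    mul_zero, Finset.sum_ite_eq', Finset.sum_ite_irrel, Finset.sum_const_zero, Finset.mem_univ,
    if_true, Matrix.neg_apply]
  rw [hB m l]
  ring

/-- The cyclic sum of the Hodge dual of a tensor `P` which is skew in both pairs of indices (given
here with the second pair raised) is the contraction of `P` against the volume form. -/
lemma cyclic_sum_dual {P : Fin 4 → Fin 4 → Fin 4 → Fin 4 → ℝ}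
    (h1 : ∀ τ ρ κ ι, P τ ρ κ ι = -P ρ τ κ ι) (h2 : ∀ τ ρ κ ι, P τ ρ κ ι = -P τ ρ ι κ)
    (e : ℝ) (ρ μ α β : Fin 4) :
    (1 / 2) * ∑ κ, ∑ ι, P μ ρ κ ι * (e * leviCivita κ ι α β)
      + (1 / 2) * ∑ κ, ∑ ι, P α ρ κ ι * (e * leviCivita κ ι β μ)
      + (1 / 2) * ∑ κ, ∑ ι, P β ρ κ ι * (e * leviCivita κ ι μ α)
      = -∑ κ, e * leviCivita μ α β κ * ∑ τ, P ρ τ τ κ := by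
  -- The identity is the contraction of the vanishing antisymmetrisation with `P`.
  have key : ∑ τ, ∑ κ, ∑ ι, P τ ρ κ ι * (e * ((
      (if τ = μ then leviCivita κ ι α β else 0) + (if τ = α then leviCivita κ ι β μ else 0)
      + (if τ = β then leviCivita κ ι μ α else 0)
      + (if τ = ι then leviCivita μ α β κ else 0) - (if τ = κ then leviCivita μ α β ι else 0)
      : ℤ) : ℝ)) = 0 := by
    simp [schouten_leviCivita]
  have e1 : ∀ (ν : Fin 4) (f : Fin 4 → Fin 4 → ℤ),
      ∑ τ, ∑ κ, ∑ ι, P τ ρ κ ι * (e * ((if τ = ν then f κ ι else 0 : ℤ) : ℝ))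
      = ∑ κ, ∑ ι, P ν ρ κ ι * (e * f κ ι) := by
    intro ν f
    rw [Finset.sum_eq_single ν]
    · simp
    · intro τ _ h
      simp [h]
    · simp
  have e2 : ∑ τ, ∑ κ, ∑ ι, P τ ρ κ ι * (e * ((if τ = ι then leviCivita μ α β κ else 0 : ℤ) : ℝ))
      = ∑ κ, e * leviCivita μ α β κ * ∑ τ, P ρ τ τ κ := by
    rw [Finset.sum_comm]
    refine Finset.sum_congr rfl fun κ _ ↦ ?_
    rw [Finset.mul_sum]
    refine Finset.sum_congr rfl fun τ _ ↦ ?_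
    simp only [Int.cast_ite, Int.cast_zero, mul_ite, mul_zero, Finset.sum_ite_eq, Finset.mem_univ,
      if_true]
    rw [h1, h2]
    ring
  have e3 : ∑ τ, ∑ κ, ∑ ι, P τ ρ κ ι * (e * ((if τ = κ then leviCivita μ α β ι else 0 : ℤ) : ℝ))
      = -∑ κ, e * leviCivita μ α β κ * ∑ τ, P ρ τ τ κ := by
    simp only [Int.cast_ite, Int.cast_zero, mul_ite, mul_zero, Finset.sum_ite_irrel,
      Finset.sum_const_zero, Finset.sum_ite_eq, Finset.mem_univ, if_true]
    rw [Finset.sum_comm, ← Finset.sum_neg_distrib]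
    refine Finset.sum_congr rfl fun κ _ ↦ ?_
    rw [Finset.mul_sum, ← Finset.sum_neg_distrib]
    refine Finset.sum_congr rfl fun τ _ ↦ ?_
    rw [h1]
    ring
  simp only [Int.cast_add, Int.cast_sub, mul_add, mul_sub, Finset.sum_add_distrib,
    Finset.sum_sub_distrib] at key
  rw [e1 μ fun κ ι ↦ leviCivita κ ι α β, e1 α fun κ ι ↦ leviCivita κ ι β μ,
    e1 β fun κ ι ↦ leviCivita κ ι μ α, e2, e3] at key
  linarith

end LeviCivita

namespace MovingFrame

variable {M : Type*} [TopologicalSpace M] [ChartedSpace E4 M] [IsManifold (𝓡 4) ∞ M]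
variable {F : MovingFrame M} {x : M}

/-! ### The dual curvature in a moving frame -/

section Hodge

/-- The value `ε_{0123}` of the volume form on the frame. -/
noncomputable def volBase (F : MovingFrame M) {g : LorentzMetric M} (τ : VolumeForm g) (x : M) :
    ℝ :=
  τ.val x fun i ↦ F.e i x

lemma vol_eq {g : LorentzMetric M} (τ : VolumeForm g) (i j k l : Fin 4) (x : M) :
    F.vol τ i j k l x = F.volBase τ x * leviCivita i j k l := by
  have h := alternatingMap_comp (τ.val x) (fun i ↦ F.e i x) ![i, j, k, l]
  rw [mul_comm]
  refine Eq.trans ?_ h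
  rw [vol]
  congr 1
  ext m
  fin_cases m <;> rfl

lemma sq_volBase {g : LorentzMetric M} (τ : VolumeForm g) (x : M) :
    F.volBase τ x ^ 2 = -(F.gram g x).det :=
  τ.normalized x _

lemma metricInv_eq (g : LorentzMetric M) (μ ν : Fin 4) (x : M) :
    F.metricInv g μ ν x = (F.gram g x)⁻¹ μ ν := rfl

lemma gram_inv_transpose (g : LorentzMetric M) (x : M) :
    ((F.gram g x)⁻¹).transpose = (F.gram g x)⁻¹ := by
  rw [Matrix.transpose_nonsing_inv, gram_transpose]

lemma sq_volBase_mul_det_inv {g : LorentzMetric M} (τ : VolumeForm g) (hx : x ∈ F.dom) :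
    F.volBase τ x ^ 2 * ((F.gram g x)⁻¹).det = -1 := by
  rw [sq_volBase, Matrix.det_nonsing_inv, Ring.inverse_eq_inv', neg_mul,
    mul_inv_cancel₀ (F.det_gram_ne_zero τ hx)]

lemma hodge_eq {g : LorentzMetric M} (τ : VolumeForm g) (B : Fin 4 → Fin 4 → M → ℝ)
    (l s : Fin 4) (x : M) :
    F.hodge τ B l s x
      = hodgeMatrix (F.gram g x)⁻¹ (F.volBase τ x) (Matrix.of fun α β ↦ B α β x) l s := by
  have h : ∀ f : Fin 4 × Fin 4 → Fin 4 × Fin 4 → ℝ, ∑ p, ∑ q, f p q = ∑ q, ∑ p, f p q :=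
    fun f ↦ Finset.sum_comm
  simp only [hodge, hodgeMatrix, Matrix.of_apply, transpose_mul_mul_apply, Finset.sum_mul,
    metricInv_eq, vol_eq]
  congr 1
  have := h fun p q ↦ (F.gram g x)⁻¹ p.1 q.1 * (F.gram g x)⁻¹ p.2 q.2 * B p.1 p.2 x
    * (F.volBase τ x * leviCivita q.1 q.2 l s)
  simp only [Fintype.sum_prod_type] at this
  rw [this]
  refine Finset.sum_congr rfl fun a _ ↦ Finset.sum_congr rfl fun b _ ↦
      Finset.sum_congr rfl fun c _ ↦ Finset.sum_congr rfl fun d _ ↦ by ring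

/-- If the curvature of `D'` is dual to that of `D`, then the dual of the curvature of `D'` is
minus the curvature of `D`. -/
lemma curvature_eq_neg_dualCurvature {g : LorentzMetric M} (τ : VolumeForm g)
    {D D' : Connection M} (h : IsDualConnection τ D D') (hx : x ∈ F.dom) (μ ρ α β : Fin 4) :
    F.curvature D μ ρ α β x = -F.dualCurvature τ D' μ ρ α β x := by
  have h1 : (Matrix.of fun α β ↦ F.curvature D' μ ρ α β x)
      = hodgeMatrix (F.gram g x)⁻¹ (F.volBase τ x)
        (Matrix.of fun α β ↦ F.curvature D μ ρ α β x) := by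
    ext α β
    rw [Matrix.of_apply, h.curvature_eq F x hx, dualCurvature, hodge_eq]
  rw [dualCurvature, hodge_eq, h1,
    hodgeMatrix_hodgeMatrix (B := Matrix.of fun α β ↦ F.curvature D μ ρ α β x)
      (gram_inv_transpose g x) (sq_volBase_mul_det_inv τ hx)
      (fun a b ↦ curvature_antisymm D μ ρ a b x)]
  simp

/-- The curvature with lowered indices and its 2-form indices raised: `R_{μρ}^{κι}`. -/
noncomputable def raisedCurvature (F : MovingFrame M) (g : LorentzMetric M) (D : Connection M)
    (x : M) (μ ρ κ ι : Fin 4) : ℝ :=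
  (((F.gram g x)⁻¹).transpose * (Matrix.of fun α β ↦ F.lower₄ g (F.curvature D) μ ρ α β x)
    * (F.gram g x)⁻¹) κ ι

lemma lower₄_curvature_skew [T2Space M] {g : LorentzMetric M} (τ : VolumeForm g)
    {D : Connection M} [CovariantDerivative.ContMDiffCovariantDerivative D ∞]
    (hD : IsMetricCompatible g D) (hx : x ∈ F.dom) (μ ρ α β : Fin 4) :
    F.lower₄ g (F.curvature D) μ ρ α β x = -F.lower₄ g (F.curvature D) ρ μ α β x := by
  have h := congrFun (congrFun (curvMatrix_skew τ hD hx α β) μ) ρ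
  have ht : (F.curvMatrix D α β x).transpose * F.gram g x
      = (F.gram g x * F.curvMatrix D α β x).transpose := by
    rw [Matrix.transpose_mul, gram_transpose]
  rw [ht, Matrix.add_apply, Matrix.transpose_apply, Matrix.zero_apply] at h
  rw [lower₄_curvature, lower₄_curvature]
  linarith

lemma raisedCurvature_skew₁ [T2Space M] {g : LorentzMetric M} (τ : VolumeForm g)
    {D : Connection M} [CovariantDerivative.ContMDiffCovariantDerivative D ∞]
    (hD : IsMetricCompatible g D) (hx : x ∈ F.dom) (μ ρ κ ι : Fin 4) :
    F.raisedCurvature g D x μ ρ κ ι = -F.raisedCurvature g D x ρ μ κ ι := by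
  simp only [raisedCurvature, transpose_mul_mul_apply, Matrix.of_apply,
    lower₄_curvature_skew τ hD hx μ ρ, mul_neg, neg_mul, Finset.sum_neg_distrib]

lemma raisedCurvature_skew₂ (g : LorentzMetric M) (D : Connection M) (x : M)
    (μ ρ κ ι : Fin 4) :
    F.raisedCurvature g D x μ ρ κ ι = -F.raisedCurvature g D x μ ρ ι κ := by
  have h : ∀ α β, F.lower₄ g (F.curvature D) μ ρ α β x
      = -F.lower₄ g (F.curvature D) μ ρ β α x := fun α β ↦ by
    rw [lower₄, lower₄, ← Finset.sum_neg_distrib]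
    exact Finset.sum_congr rfl fun σ _ ↦ by rw [curvature_antisymm]; ring
  simp only [raisedCurvature, transpose_mul_mul_apply, Matrix.of_apply]
  rw [Finset.sum_comm, ← Finset.sum_neg_distrib]
  refine Finset.sum_congr rfl fun β _ ↦ ?_
  rw [← Finset.sum_neg_distrib]
  refine Finset.sum_congr rfl fun α _ ↦ ?_
  rw [h]
  ring

lemma lower₄_dualCurvature {g : LorentzMetric M} (τ : VolumeForm g) (D : Connection M)
    (μ ρ α β : Fin 4) (x : M) :
    F.lower₄ g (F.dualCurvature τ D) μ ρ α β x
      = (1 / 2) * ∑ κ, ∑ ι, F.raisedCurvature g D x μ ρ κ ι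
        * (F.volBase τ x * leviCivita κ ι α β) := by
  have h : ∀ κ ι, F.raisedCurvature g D x μ ρ κ ι = ∑ σ, F.metric g ρ σ x
      * (((F.gram g x)⁻¹).transpose * (Matrix.of fun α β ↦ F.curvature D μ σ α β x)
        * (F.gram g x)⁻¹) κ ι := by
    intro κ ι
    have : (Matrix.of fun α β ↦ F.lower₄ g (F.curvature D) μ ρ α β x)
        = ∑ σ, F.metric g ρ σ x • Matrix.of fun α β ↦ F.curvature D μ σ α β x := by
      ext α β
      simp [lower₄, Matrix.sum_apply]
    rw [raisedCurvature, this]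
    simp only [Finset.mul_sum, Finset.sum_mul, Matrix.mul_smul, Matrix.smul_mul,
      Matrix.sum_apply, Matrix.smul_apply, smul_eq_mul]
  simp only [lower₄, dualCurvature, hodge_eq, hodgeMatrix, Matrix.of_apply, h]
  simp only [Finset.mul_sum, Finset.sum_mul]
  rw [Finset.sum_comm]
  refine Finset.sum_congr rfl fun κ _ ↦ ?_
  rw [Finset.sum_comm]
  exact Finset.sum_congr rfl fun _ _ ↦ Finset.sum_congr rfl fun _ _ ↦ by ring

/-- The mixed Ricci tensor `R_ρ^κ`. -/
noncomputable def ricciMixed (F : MovingFrame M) (g : LorentzMetric M) (D : Connection M)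
    (ρ κ : Fin 4) (x : M) : ℝ :=
  ∑ ν, F.ricci D ρ ν x * F.metricInv g ν κ x

/-- The contraction `R_{ρτ}^{τκ}` is the mixed Ricci tensor. -/
lemma sum_raisedCurvature {g : LorentzMetric M} (τ : VolumeForm g) (D : Connection M)
    (hx : x ∈ F.dom) (ρ κ : Fin 4) :
    ∑ σ, F.raisedCurvature g D x ρ σ σ κ = F.ricciMixed g D ρ κ x := by
  have hinv : ∀ α γ, ∑ σ, (F.gram g x)⁻¹ α σ * F.metric g σ γ x = if α = γ then 1 else 0 := by
    intro α γ
    have := congrFun (congrFun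
      (Matrix.nonsing_inv_mul _ (F.det_gram_ne_zero τ hx).isUnit) α) γ
    rw [Matrix.mul_apply, Matrix.one_apply] at this
    exact this
  have h1 : ∑ σ, F.raisedCurvature g D x ρ σ σ κ
      = ∑ β, ∑ α, ∑ γ, (∑ σ, (F.gram g x)⁻¹ α σ * F.metric g σ γ x)
        * F.curvature D ρ γ α β x * (F.gram g x)⁻¹ β κ := by
    simp only [raisedCurvature, transpose_mul_mul_apply, Matrix.of_apply, lower₄, Finset.mul_sum,
      Finset.sum_mul]
    rw [Finset.sum_congr rfl fun σ _ ↦ Finset.sum_comm, Finset.sum_comm]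
    refine Finset.sum_congr rfl fun β _ ↦ ?_
    rw [Finset.sum_comm]
    refine Finset.sum_congr rfl fun α _ ↦ ?_
    rw [Finset.sum_comm]
    exact Finset.sum_congr rfl fun _ _ ↦ Finset.sum_congr rfl fun _ _ ↦ by ring
  rw [h1]
  simp only [hinv, ite_mul, one_mul, zero_mul, Finset.sum_ite_eq, Finset.mem_univ, if_true,
    ricciMixed, ricci, Finset.sum_mul, metricInv_eq]

/-- The cyclic sum of the dual curvature is the mixed Ricci tensor contracted with the volume
form. -/
lemma sum_lower₄_dualCurvature [T2Space M] {g : LorentzMetric M} (τ : VolumeForm g)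
    {D : Connection M} [CovariantDerivative.ContMDiffCovariantDerivative D ∞]
    (hD : IsMetricCompatible g D) (hx : x ∈ F.dom) (ρ μ α β : Fin 4) :
    F.lower₄ g (F.dualCurvature τ D) μ ρ α β x + F.lower₄ g (F.dualCurvature τ D) α ρ β μ x
      + F.lower₄ g (F.dualCurvature τ D) β ρ μ α x
      = -∑ κ, F.vol τ μ α β κ x * F.ricciMixed g D ρ κ x := by
  simp only [lower₄_dualCurvature, vol_eq, ← sum_raisedCurvature τ D hx]
  exact cyclic_sum_dual (raisedCurvature_skew₁ τ hD hx) (raisedCurvature_skew₂ g D x) _ _ _ _ _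

end Hodge

/-! ### Einstein's equation -/

section Einstein

lemma mixed_eq {g : LorentzMetric M} (τ : VolumeForm g) {D : Connection M}
    {S : ∀ x : M, TangentSpace (𝓡 4) x →L[ℝ] TangentSpace (𝓡 4) x →L[ℝ] ℝ}
    (hE : EinsteinEquation g D S) (hx : x ∈ F.dom) (ρ κ : Fin 4) :
    F.mixed g S ρ κ x
      = F.ricciMixed g D ρ κ x - (1 / 2) * F.scalar g D x * (if ρ = κ then 1 else 0) := by
  have hinv : ∑ ν, F.metric g ρ ν x * F.metricInv g ν κ x = if ρ = κ then 1 else 0 := by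
    have := congrFun (congrFun
      (Matrix.mul_nonsing_inv _ (F.det_gram_ne_zero τ hx).isUnit) ρ) κ
    rw [Matrix.mul_apply, Matrix.one_apply] at this
    exact this
  rw [← hinv, mixed, ricciMixed, Finset.mul_sum, ← Finset.sum_sub_distrib]
  refine Finset.sum_congr rfl fun ν _ ↦ ?_
  rw [← hE F x hx, einstein]
  ring

/-- Einstein's equation contracted with the volume form: the scalar curvature term cancels against
the one contained in the Einstein tensor. -/
lemma sum_vol_mixed {g : LorentzMetric M} (τ : VolumeForm g) {D : Connection M}
    {S : ∀ x : M, TangentSpace (𝓡 4) x →L[ℝ] TangentSpace (𝓡 4) x →L[ℝ] ℝ}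
    (hE : EinsteinEquation g D S) (hx : x ∈ F.dom) (ρ μ α β : Fin 4) :
    (∑ κ, F.vol τ μ α β κ x * F.mixed g S ρ κ x)
        - (1 / 2) * F.scalar g D x * F.vol τ ρ μ α β x
      = ∑ κ, F.vol τ μ α β κ x * F.ricciMixed g D ρ κ x := by
  have hr : F.vol τ μ α β ρ x = -F.vol τ ρ μ α β x := by
    rw [vol_eq, vol_eq, leviCivita_rotate μ α β ρ]
    simp
  simp only [mixed_eq τ hE hx, mul_sub, Finset.sum_sub_distrib, mul_ite, mul_one, mul_zero,
    Finset.sum_ite_eq, Finset.mem_univ, if_true, hr]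
  ring

lemma trace_eq_neg_scalar {g : LorentzMetric M} (τ : VolumeForm g) {D : Connection M}
    {S : ∀ x : M, TangentSpace (𝓡 4) x →L[ℝ] TangentSpace (𝓡 4) x →L[ℝ] ℝ}
    (hE : EinsteinEquation g D S) (hx : x ∈ F.dom) : F.trace g S x = -F.scalar g D x := by
  have hs : ∀ μ ν, F.metricInv g μ ν x = F.metricInv g ν μ x := fun μ ν ↦
    congrFun (congrFun (gram_inv_transpose g x) ν) μ
  have h1 : ∑ κ, F.ricciMixed g D κ κ x = F.scalar g D x := by
    simp only [ricciMixed, scalar]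
    exact Finset.sum_congr rfl fun κ _ ↦ Finset.sum_congr rfl fun ν _ ↦ by
      rw [hs ν κ, mul_comm]
  rw [trace]
  simp only [mixed_eq τ hE hx, Finset.sum_sub_distrib, h1, if_true, mul_one, Finset.sum_const,
    Finset.card_univ, Fintype.card_fin, nsmul_eq_mul]
  push_cast
  ring

lemma dualScalar_eq_scalar {g : LorentzMetric M} (τ : VolumeForm g) {D D' : Connection M}
    (h : IsDualConnection τ D D') (hx : x ∈ F.dom) : F.dualScalar τ D x = F.scalar g D' x := by
  simp only [dualScalar, scalar, ricci, h.curvature_eq F x hx]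

end Einstein

/-! ### The field equations as first Bianchi identities -/

section FieldEquations

variable [T2Space M] {g : LorentzMetric M} (τ : VolumeForm g) {D D' : Connection M}
  [CovariantDerivative.ContMDiffCovariantDerivative D ∞]
  [CovariantDerivative.ContMDiffCovariantDerivative D' ∞]
  {S S' : ∀ x : M, TangentSpace (𝓡 4) x →L[ℝ] TangentSpace (𝓡 4) x →L[ℝ] ℝ}

/-- Einstein's equation for `D`, read as the first Bianchi identity of the dual connection `D'`. -/
lemma bianchiSum_dualTorsion (hD : IsMetricCompatible g D) (hD' : IsMetricCompatible g D')
    (hE : EinsteinEquation g D S) (hdual : IsDualConnection τ D D') (hx : x ∈ F.dom)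
    (ρ μ α β : Fin 4) :
    -((∑ κ, F.vol τ μ α β κ x * F.mixed g S ρ κ x)
        - (1 / 2) * F.scalar g D x * F.vol τ ρ μ α β x)
      = F.bianchiSum g D' (F.dualTorsion τ D) ρ μ α β x := by
  have h : ∀ μ ρ α β, F.lower₄ g (F.curvature D') μ ρ α β x
      = F.lower₄ g (F.dualCurvature τ D) μ ρ α β x := fun μ ρ α β ↦ by
    simp only [lower₄, hdual.curvature_eq F x hx]
  rw [← bianchiSum_congr (hdual.torsion_eq F) hx, bianchiSum_torsion τ hD' hx, h, h, h,
    sum_lower₄_dualCurvature τ hD hx, sum_vol_mixed τ hE hx]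

/-- Einstein's equation for `D'`, read as the first Bianchi identity of `D`; the opposite sign comes
from `⋆⋆ = -1`. -/
lemma bianchiSum_torsion_of_dual (hD : IsMetricCompatible g D) (hD' : IsMetricCompatible g D')
    (hE' : EinsteinEquation g D' S') (hdual : IsDualConnection τ D D') (hx : x ∈ F.dom)
    (ρ μ α β : Fin 4) :
    (∑ κ, F.vol τ μ α β κ x * F.mixed g S' ρ κ x)
        - (1 / 2) * F.dualScalar τ D x * F.vol τ ρ μ α β x
      = F.bianchiSum g D (F.torsion D) ρ μ α β x := by
  have h : ∀ μ ρ α β, F.lower₄ g (F.curvature D) μ ρ α β x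
      = -F.lower₄ g (F.dualCurvature τ D') μ ρ α β x := fun μ ρ α β ↦ by
    simp only [lower₄, curvature_eq_neg_dualCurvature τ hdual hx, mul_neg,
      Finset.sum_neg_distrib]
  rw [bianchiSum_torsion τ hD hx, h, h, h, dualScalar_eq_scalar τ hdual hx,
    sum_vol_mixed τ hE' hx]
  linarith [sum_lower₄_dualCurvature τ hD' hx ρ μ α β]

end FieldEquations

/-! ### The torsion-free case -/

section TorsionFree

lemma bianchiSum_zero (g : LorentzMetric M) (D : Connection M) (ρ μ α β : Fin 4) (x : M) :
    F.bianchiSum g D (fun _ _ _ _ ↦ 0) ρ μ α β x = 0 := by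
  have h : F.lower₃ g (fun _ _ _ _ ↦ 0) = fun _ _ _ _ ↦ 0 := by
    funext ρ α β y
    simp [lower₃]
  simp [bianchiSum, h, covDeriv₃, mvfderiv_const]

lemma torsion_of_torsion_eq_zero {D : Connection M} (hT : D.torsion = 0) (ρ α β : Fin 4) (x : M) :
    F.torsion D ρ α β x = 0 := by
  simp [torsion, hT]

lemma dualTorsion_of_torsion_eq_zero {g : LorentzMetric M} (τ : VolumeForm g)
    {D : Connection M} (hT : D.torsion = 0) (ρ α β : Fin 4) (x : M) :
    F.dualTorsion τ D ρ α β x = 0 := by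
  simp [dualTorsion, hodge, torsion_of_torsion_eq_zero hT]

/-- Every point lies in the domain of some moving frame. -/
lemma exists_mem_dom (x : M) : ∃ F : MovingFrame M, x ∈ F.dom :=
  ⟨{ dom := (trivializationAt E4 (TangentSpace (𝓡 4) : M → Type _) x).baseSet
     isOpen_dom := (trivializationAt E4 (TangentSpace (𝓡 4) : M → Type _) x).open_baseSet
     e := (trivializationAt E4 (TangentSpace (𝓡 4) : M → Type _) x).localFrame
       (EuclideanSpace.basisFun (Fin 4) ℝ).toBasis
     isLocalFrameOn := Bundle.Trivialization.isLocalFrameOn_localFrame_baseSet (𝓡 4) ∞ _ _ },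
    FiberBundle.mem_baseSet_trivializationAt' x⟩

lemma torsion_eq_zero_of_dual {g : LorentzMetric M} (τ : VolumeForm g) {D D' : Connection M}
    (hdual : IsDualConnection τ D D') (hT : D.torsion = 0) : D'.torsion = 0 := by
  funext x
  obtain ⟨F, hx⟩ := exists_mem_dom x
  have h : ∀ α β, D'.torsion x (F.e α x) (F.e β x) = 0 := by
    intro α β
    rw [F.sum_coframe_smul hx (D'.torsion x (F.e α x) (F.e β x))]
    refine Finset.sum_eq_zero fun ρ _ ↦ ?_
    have := hdual.torsion_eq F x hx ρ α β
    rw [dualTorsion_of_torsion_eq_zero τ hT] at this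
    rw [torsion] at this
    rw [this, zero_smul]
  ext1 v
  ext1 w
  rw [F.sum_coframe_smul hx v, F.sum_coframe_smul hx w]
  simp [h]

end TorsionFree

end MovingFrame

end RiemannCartan

theorem mainTheorem3
    {M : Type*} [TopologicalSpace M] [T2Space M] [ChartedSpace RiemannCartan.E4 M]
    [IsManifold (𝓡 4) ∞ M]
    (g : RiemannCartan.LorentzMetric M) (τ : RiemannCartan.VolumeForm g)
    (D D' : RiemannCartan.Connection M)
    [CovariantDerivative.ContMDiffCovariantDerivative D ∞]
    [CovariantDerivative.ContMDiffCovariantDerivative D' ∞]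
    (hD : RiemannCartan.IsMetricCompatible g D) (hD' : RiemannCartan.IsMetricCompatible g D')
    (S S' : ∀ x : M, TangentSpace (𝓡 4) x →L[ℝ] TangentSpace (𝓡 4) x →L[ℝ] ℝ)
    (hE : RiemannCartan.EinsteinEquation g D S) (hE' : RiemannCartan.EinsteinEquation g D' S')
    (hdual : RiemannCartan.IsDualConnection τ D D') :
    (∀ (F : RiemannCartan.MovingFrame M), ∀ x ∈ F.dom, ∀ ρ μ α β : Fin 4,
      -((∑ κ, F.vol τ μ α β κ x * F.mixed g S ρ κ x)
          - (1 / 2) * F.scalar g D x * F.vol τ ρ μ α β x)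
        = F.bianchiSum g D' (F.dualTorsion τ D) ρ μ α β x) ∧
    (∀ (F : RiemannCartan.MovingFrame M), ∀ x ∈ F.dom, ∀ ρ μ α β : Fin 4,
      (∑ κ, F.vol τ μ α β κ x * F.mixed g S' ρ κ x)
          - (1 / 2) * F.dualScalar τ D x * F.vol τ ρ μ α β x
        = F.bianchiSum g D (F.torsion D) ρ μ α β x) ∧
    (D.torsion = 0 →
      D'.torsion = 0 ∧
      (∀ (F : RiemannCartan.MovingFrame M), ∀ x ∈ F.dom, ∀ μ ρ l s : Fin 4,
        ∑ κ, F.vol τ ρ l s κ x * F.mixed g S μ κ x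
          = -(1 / 2) * F.trace g S x * F.vol τ μ ρ l s x) ∧
      (∀ (F : RiemannCartan.MovingFrame M), ∀ x ∈ F.dom, ∀ μ ρ l s : Fin 4,
        ∑ κ, F.vol τ ρ l s κ x * F.mixed g S' μ κ x
          = -(1 / 2) * F.trace g S' x * F.vol τ μ ρ l s x) ∧
      (∀ (F : RiemannCartan.MovingFrame M), ∀ x ∈ F.dom, ∀ μ ν ρ α β : Fin 4,
        F.covDeriv₄ D' (F.lower₄ g (F.dualCurvature τ D)) μ β α ν ρ x
            + F.covDeriv₄ D' (F.lower₄ g (F.dualCurvature τ D)) ν β α ρ μ x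
            + F.covDeriv₄ D' (F.lower₄ g (F.dualCurvature τ D)) ρ β α μ ν x
          = F.covDeriv₄ D (F.lower₄ g (F.curvature D)) μ β α ν ρ x
            + F.covDeriv₄ D (F.lower₄ g (F.curvature D)) ν β α ρ μ x
            + F.covDeriv₄ D (F.lower₄ g (F.curvature D)) ρ β α μ ν x)) := by
  have hB : ∀ (F : RiemannCartan.MovingFrame M), ∀ x ∈ F.dom, ∀ ρ μ α β : Fin 4, _ :=
    fun F x hx ρ μ α β ↦
      RiemannCartan.MovingFrame.bianchiSum_dualTorsion (F := F) τ hD hD' hE hdual hx ρ μ α β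
  have hB' : ∀ (F : RiemannCartan.MovingFrame M), ∀ x ∈ F.dom, ∀ ρ μ α β : Fin 4, _ :=
    fun F x hx ρ μ α β ↦
      RiemannCartan.MovingFrame.bianchiSum_torsion_of_dual (F := F) τ hD hD' hE' hdual hx ρ μ α β
  refine ⟨hB, hB', fun hT ↦ ?_⟩
  have hT' : D'.torsion = 0 := RiemannCartan.MovingFrame.torsion_eq_zero_of_dual τ hdual hT
  refine ⟨hT', fun F x hx μ ρ l s ↦ ?_, fun F x hx μ ρ l s ↦ ?_, fun F x hx μ ν ρ α β ↦ ?_⟩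
  · have h := hB F x hx μ ρ l s
    rw [RiemannCartan.MovingFrame.bianchiSum_congr (fun y _ ρ α β ↦
      RiemannCartan.MovingFrame.dualTorsion_of_torsion_eq_zero τ hT ρ α β y) hx,
      RiemannCartan.MovingFrame.bianchiSum_zero] at h
    rw [RiemannCartan.MovingFrame.trace_eq_neg_scalar τ hE hx]
    linarith
  · have h := hB' F x hx μ ρ l s
    rw [RiemannCartan.MovingFrame.bianchiSum_congr (fun y _ ρ α β ↦
      RiemannCartan.MovingFrame.torsion_of_torsion_eq_zero hT ρ α β y) hx,
      RiemannCartan.MovingFrame.bianchiSum_zero,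
      RiemannCartan.MovingFrame.dualScalar_eq_scalar τ hdual hx] at h
    rw [RiemannCartan.MovingFrame.trace_eq_neg_scalar τ hE' hx]
    linarith
  · have hl : ∀ y ∈ F.dom, ∀ β α ν ρ, F.lower₄ g (F.dualCurvature τ D) β α ν ρ y
        = F.lower₄ g (F.curvature D') β α ν ρ y := fun y hy β α ν ρ ↦ by
      simp only [RiemannCartan.MovingFrame.lower₄, hdual.curvature_eq F y hy]
    -- Both sides vanish, by the second Bianchi identities of `D` and `D'`.
    simp only [RiemannCartan.MovingFrame.covDeriv₄_congr hl hx,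
      RiemannCartan.MovingFrame.sum_covDeriv₄_curvature τ hD' hT' hx,
      RiemannCartan.MovingFrame.sum_covDeriv₄_curvature τ hD hT hx]
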